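/- **Setting.** Let $\boldsymbol{\mathcal X}=[\boldsymbol X_1\ \boldsymbol X_2\ \cdots\ \boldsymbol X_p]\in\mathbb R^{m\times ps}$ with blocks $\boldsymbol X_k\in\mathbb R^{m\times s}$, $p,s\ge 1$. $\|\cdot\|$ is the spectral norm and $\kappa(A)=\sigma_{\max}(A)/\sigma_{\min}(A)$ is the 2-norm condition number ($\kappa(A)=\infty$ if $A$ does not have full column rank). The algorithm BCGSI+A-3S, with intraorthogonalization routines $\mathrm{IO_A}$ and $\mathrm{IO}$ (each takes an $m\times s$ matrix to a pair of an $m\times s$ and an $s\times s$ matrix), is: $[\boldsymbol Q_1,R_{11}]=\mathrm{IO_A}(\boldsymbol X_1)$, and for $k=2,\dots,p$, with $\boldsymbol{\mathcal Q}_{k-1}=[\boldsymbol Q_1\cdots\boldsymbol Q_{k-1}]$, $$\mathcal S_{1:k-1,k}=\boldsymbol{\mathcal Q}_{k-1}^T\boldsymbol X_k,\quad \boldsymbol V_k=\boldsymbol X_k-\boldsymbol{\mathcal Q}_{k-1}\mathcal S_{1:k-1,k},\quad \mathcal Y_{1:k-1,k}=\boldsymbol{\mathcal Q}_{k-1}^T\boldsymbol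 V_k,$$ $$[\boldsymbol Q_k,R_{kk}]=\mathrm{IO}(\boldsymbol V_k-\boldsymbol{\mathcal Q}_{k-1}\mathcal Y_{1:k-1,k}),\qquad \mathcal R_{1:k-1,k}=\mathcal S_{1:k-1,k}+\mathcal Y_{1:k-1,k},$$ with $R_{jk}=0$ for $j>k$. Let $\bar{\boldsymbol{\mathcal Q}}\in\mathbb R^{m\times ps}$ and $\bar{\mathcal R}\in\mathbb R^{ps\times ps}$ be its computed results in floating-point arithmetic with unit roundoff $\varepsilon>0$: every elementary addition, subtraction and multiplication outside the routines returns its exact result times $1+\delta$ with some $|\delta|\le\varepsilon$ (standard model), sums are evaluated in any order, and $\mathrm{IO_A}$, $\mathrm{IO}$ stand for the routines as executed in finite precision. **Theorem.** Let $m$, $p$, $s$, real exponents $\alpha_A\le\alpha$, and constants $c$ and $\tau>1$ be given. There are positive constants $C_0,C_1,C_2$, depending only on these data, such that the following holds for every $\varepsilon>0$, all routines $\mathrm{IO_A}$, $\mathrm{IO}$ and every $\boldsymbol{\mathcal X}$ of full column rank. Assume that for all $\boldsymbol X\in\mathbb R^{m\times s}$ of full column rank with $\kappa(\boldsymbol X)\le\kappa(\boldsymbol{\mathcal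 X})$ the pair $[\bar{\boldsymbol Q},\bar R]=\mathrm{IO_A}(\boldsymbol X)$ satisfies $$\boldsymbol X+\Delta\boldsymbol X=\bar{\boldsymbol Q}\bar R\ \text{ for some }\Delta\boldsymbol X\text{ with }\|\Delta\boldsymbol X\|\le c\,\varepsilon\|\boldsymbol X\|,\qquad \|I-\bar{\boldsymbol Q}^T\bar{\boldsymbol Q}\|\le c\,\varepsilon\,\kappa^{\alpha_A}(\boldsymbol X),$$ and that for all $\boldsymbol X\in\mathbb R^{m\times s}$ of full column rank with $\kappa(\boldsymbol X)\le\tau\,\kappa(\boldsymbol{\mathcal X})$ the pair $[\bar{\boldsymbol Q},\bar R]=\mathrm{IO}(\boldsymbol X)$ satisfies $$\boldsymbol X+\Delta\boldsymbol X=\bar{\boldsymbol Q}\bar R\ \text{ for some }\Delta\boldsymbol X\text{ with }\|\Delta\boldsymbol X\|\le c\,\varepsilon\|\boldsymbol X\|,\qquad \|I-\bar{\boldsymbol Q}^T\bar{\boldsymbol Q}\|\le c\,\varepsilon\,\kappa^{\alpha}(\boldsymbol X).$$ If $C_0\,\varepsilon\,\kappa^{\theta}(\boldsymbol{\mathcal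 X})\le\frac12$ with $\theta=\max(\alpha+1,2)$, then $$\boldsymbol{\mathcal X}+\Delta\boldsymbol{\mathcal X}=\bar{\boldsymbol{\mathcal Q}}\bar{\mathcal R}\ \text{ for some }\Delta\boldsymbol{\mathcal X}\text{ with }\|\Delta\boldsymbol{\mathcal X}\|\le C_1\,\varepsilon\,\|\boldsymbol{\mathcal X}\|,$$ $$\|I-\bar{\boldsymbol{\mathcal Q}}^T\bar{\boldsymbol{\mathcal Q}}\|\le C_2\,\varepsilon\,\kappa^{\max(\alpha,1)}(\boldsymbol{\mathcal X}).$$ -/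

import Mathlib

open scoped Matrix Matrix.Norms.L2Operator

namespace BlockGS

/-- `σ_min(A)`: the smallest of the singular values of a real matrix `A` with
`n` columns, i.e. the `n`-th one in decreasing order. It is positive exactly when `A` has full
column rank. -/
noncomputable def sigmaMin {μ ν : Type*} [Fintype μ] [DecidableEq μ] [Fintype ν] [DecidableEq ν]
    (A : Matrix μ ν ℝ) : ℝ :=
  (Matrix.toEuclideanLin A).singularValues (Fintype.card ν - 1)

/-- `σ_max(A)`: the largest singular value. -/
noncomputable def sigmaMax {μ ν : Type*} [Fintype μ] [DecidableEq μ] [Fintype ν] [DecidableEq ν]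
    (A : Matrix μ ν ℝ) : ℝ :=
  (Matrix.toEuclideanLin A).singularValues 0

/-- The 2-norm condition number `κ(A) = σ_max(A) / σ_min(A)` of a matrix with full column rank.
(For a matrix without full column rank `κ(A) = ∞`; the value here is then irrelevant, and every use
below is accompanied by `0 < sigmaMin A`.) -/
noncomputable def kappa {μ ν : Type*} [Fintype μ] [DecidableEq μ] [Fintype ν] [DecidableEq ν]
    (A : Matrix μ ν ℝ) : ℝ :=
  sigmaMax A / sigmaMin A

/-- The standard model of floating-point arithmetic with unit roundoff `ε`: `y` is an admissible
result of an elementary operation with exact result `x`, that is, `y = x (1 + δ)` with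
`|δ| ≤ ε`. -/
def Rounded (ε x y : ℝ) : Prop :=
  ∃ δ : ℝ, |δ| ≤ ε ∧ y = x * (1 + δ)

/-- `RoundedSum ε t z`: `z` is a floating-point evaluation of the sum of the (nonempty) multiset
`t`, by binary additions carried out in some arbitrary order (an arbitrary binary tree), every one
of them rounded. -/
inductive RoundedSum (ε : ℝ) : Multiset ℝ → ℝ → Prop
  | single (x : ℝ) : RoundedSum ε {x} x
  | add {t u : Multiset ℝ} {a b c : ℝ} (ha : RoundedSum ε t a) (hb : RoundedSum ε u b)
      (hc : Rounded ε (a + b) c) : RoundedSum ε (t + u) c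

/-- `C` is a floating-point evaluation of the matrix sum `A + B`. -/
def ComputedAdd {μ ν : Type*} (ε : ℝ) (A B C : Matrix μ ν ℝ) : Prop :=
  ∀ i j, Rounded ε (A i j + B i j) (C i j)

/-- `C` is a floating-point evaluation of the matrix product `A * B`: every entry is obtained by
rounded multiplications and a rounded summation in an arbitrary order. -/
def ComputedMul {μ ι ν : Type*} [Fintype ι] (ε : ℝ) (A : Matrix μ ι ℝ) (B : Matrix ι ν ℝ)
    (C : Matrix μ ν ℝ) : Prop :=
  ∀ i j, ∃ q : ι → ℝ, (∀ l, Rounded ε (A i l * B l j) (q l)) ∧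
    RoundedSum ε (Finset.univ.val.map q) (C i j)

/-- `C` is a floating-point evaluation of the update `D - A * B`: every entry is obtained by rounded
multiplications and a rounded summation of `D i j` and the negated products in an arbitrary order
(in particular, first evaluating the product and then subtracting it is allowed). -/
def ComputedSubMul {μ ι ν : Type*} [Fintype ι] (ε : ℝ) (D : Matrix μ ν ℝ) (A : Matrix μ ι ℝ)
    (B : Matrix ι ν ℝ) (C : Matrix μ ν ℝ) : Prop :=
  ∀ i j, ∃ q : ι → ℝ, (∀ l, Rounded ε (A i l * B l j) (q l)) ∧
    RoundedSum ε (D i j ::ₘ Finset.univ.val.map (fun l => -q l)) (C i j)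

/-- The concatenation `[X_1 X_2 ⋯ X_p]` of `p` block vectors of size `m × s`. The column index
`(k, b)` is column `b` of block `k`. -/
def concat {m p s : ℕ} (X : Fin p → Matrix (Fin m) (Fin s) ℝ) :
    Matrix (Fin m) (Fin p × Fin s) ℝ :=
  Matrix.of fun i kb => X kb.1 i kb.2

/-- The concatenation `[X_1 ⋯ X_{k-1}]` of the blocks that precede block `k`. -/
def concatBefore {m p s : ℕ} (X : Fin p → Matrix (Fin m) (Fin s) ℝ) (k : Fin p) :
    Matrix (Fin m) ({j : Fin p // j < k} × Fin s) ℝ :=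
  Matrix.of fun i jb => X jb.1.1 i jb.2

/-- The block column `R_{1:k-1,k}`. -/
def blockColumn {p s : ℕ} (R : Fin p → Fin p → Matrix (Fin s) (Fin s) ℝ) (k : Fin p) :
    Matrix ({j : Fin p // j < k} × Fin s) (Fin s) ℝ :=
  Matrix.of fun ja b => R ja.1.1 k ja.2 b

/-- The `ps × ps` matrix with the `s × s` blocks `R_{jk}`. -/
def blockMatrix {p s : ℕ} (R : Fin p → Fin p → Matrix (Fin s) (Fin s) ℝ) :
    Matrix (Fin p × Fin s) (Fin p × Fin s) ℝ :=
  Matrix.of fun ja kb => R ja.1 kb.1 ja.2 kb.2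

/-- An intraorthogonalization routine as it is executed in finite precision: it takes a block
vector to the pair of computed factors. -/
abbrev IntraOrtho (m s : ℕ) : Type :=
  Matrix (Fin m) (Fin s) ℝ → Matrix (Fin m) (Fin s) ℝ × Matrix (Fin s) (Fin s) ℝ

/-- The pair `[Q, R] = io(X)` has relative backward error at most `η`, and the loss of
orthogonality is at most `η * κ(X)^a`. -/
def IntraOrthoBounds {m s : ℕ} (io : IntraOrtho m s) (η a : ℝ) (X : Matrix (Fin m) (Fin s) ℝ) : Prop :=
  (∃ ΔX : Matrix (Fin m) (Fin s) ℝ, X + ΔX = (io X).1 * (io X).2 ∧ ‖ΔX‖ ≤ η * ‖X‖) ∧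
    ‖(1 : Matrix (Fin s) (Fin s) ℝ) - (io X).1ᵀ * (io X).1‖ ≤ η * kappa X ^ a

/-- `Q` and `R` are computed results of the algorithm BCGSI+A-3S applied to the blocks `X`, in
floating-point arithmetic with unit roundoff `ε`. The first block has index `0`:
* `[Q_1, R_11] = ioA(X_1)`;
* for `k = 2, …, p`: `S = Q_{1:k-1}ᵀ X_k`, `V = X_k - Q_{1:k-1} S`, `Y = Q_{1:k-1}ᵀ V`,
  `[Q_k, R_kk] = io(V - Q_{1:k-1} Y)` and `R_{1:k-1,k} = S + Y`. -/
structure IsComputedBCGSIA3S {m p s : ℕ} [NeZero p] (ε : ℝ) (ioA io : IntraOrtho m s)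
    (X : Fin p → Matrix (Fin m) (Fin s) ℝ) (Q : Fin p → Matrix (Fin m) (Fin s) ℝ)
    (R : Fin p → Fin p → Matrix (Fin s) (Fin s) ℝ) : Prop where
  first : (Q 0, R 0 0) = ioA (X 0)
  step : ∀ k : Fin p, k ≠ 0 →
    ∃ (S Y : Matrix ({j : Fin p // j < k} × Fin s) (Fin s) ℝ) (V W : Matrix (Fin m) (Fin s) ℝ),
      ComputedMul ε (concatBefore Q k)ᵀ (X k) S ∧
      ComputedSubMul ε (X k) (concatBefore Q k) S V ∧
      ComputedMul ε (concatBefore Q k)ᵀ V Y ∧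
      ComputedSubMul ε V (concatBefore Q k) Y W ∧
      (Q k, R k k) = io W ∧
      ComputedAdd ε S Y (blockColumn R k)
  lower : ∀ j k : Fin p, k < j → R j k = 0

end BlockGS

set_option linter.unusedSectionVars false

namespace BlockGS

/-! ### Spectral norm against vectors, entries and column selections -/

section Norms

variable {μ ι ν : Type*} [Fintype μ] [DecidableEq μ] [Fintype ι] [DecidableEq ι]
  [Fintype ν] [DecidableEq ν]

/-! Let κ, σ and N be the condition number, smallest singular value and norm of the full matrix, and
β = max(α, 1), so that θ = β + 1. Blocks are adjoined one at a time; Q holds the blocks found so far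
and ω bounds ‖1 - QᵀQ‖.

Residual: the errors of one block step telescope. As long as ω ≤ 1, the projection coefficients T
and the input W of `io` satisfy Q T + W = X_k up to O(ε)N, however large the loss of orthogonality
is otherwise (`norm_two_projection_steps`).

Conditioning: up to small errors W v is X_k v plus a combination of the preceding columns, so ‖W v‖
≥ (σ - O(ε)N)‖v‖ (`lower_bound_of_residual`), while ‖W‖ ≤ (1 + O(ε))N because ‖1 - QQᵀ‖ ≤ 1. Hence
κ(W) ≤ τκ, the assumption on `io` applies, and the new diagonal block of the Gram matrix has defect
at most cε(τκ)^β.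

Coupling: from Qᵀ(1 - QQᵀ)² = (1 - QᵀQ)²Qᵀ, the second projection leaves ‖QᵀW‖ = O(ω² + ε)N
(`norm_transpose_mul_le_of_two_steps`). Dividing by R_kk costs a factor O(1/σ), which gives κ(ω² +
ε). For ω = O(εκ^β), the product κω² is O(εκ^β · εκ^θ), whose last factor is at most 1; and εκ ≤
εκ^β since β ≥ 1. The order εκ^β thus survives from block to block, and only the constant grows
(`orthConstant`). -/

lemma norm_toEuclideanLin_le (A : Matrix μ ν ℝ) (x : EuclideanSpace ℝ ν) :
    ‖Matrix.toEuclideanLin A x‖ ≤ ‖A‖ * ‖x‖ :=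
  A.l2_opNorm_mulVec x

lemma norm_le_of_forall_toEuclideanLin (A : Matrix μ ν ℝ) {b : ℝ} (hb : 0 ≤ b)
    (h : ∀ x, ‖Matrix.toEuclideanLin A x‖ ≤ b * ‖x‖) : ‖A‖ ≤ b := by
  rw [Matrix.l2_opNorm_def]
  exact ContinuousLinearMap.opNorm_le_bound _ hb h

lemma toEuclideanLin_mul_apply (A : Matrix μ ι ℝ) (B : Matrix ι ν ℝ) (x : EuclideanSpace ℝ ν) :
    Matrix.toEuclideanLin (A * B) x = Matrix.toEuclideanLin A (Matrix.toEuclideanLin B x) := by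
  simp [Matrix.toLpLin_apply, Matrix.mulVec_mulVec]

lemma norm_transpose (A : Matrix μ ν ℝ) : ‖Aᵀ‖ = ‖A‖ := by
  rw [← Matrix.conjTranspose_eq_transpose_of_trivial, Matrix.l2_opNorm_conjTranspose]

lemma norm_transpose_mul_self (A : Matrix μ ν ℝ) : ‖Aᵀ * A‖ = ‖A‖ * ‖A‖ := by
  rw [← Matrix.conjTranspose_eq_transpose_of_trivial, Matrix.l2_opNorm_conjTranspose_mul_self]

lemma norm_one_le : ‖(1 : Matrix ν ν ℝ)‖ ≤ 1 :=
  norm_le_of_forall_toEuclideanLin _ zero_le_one fun x => by simp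

lemma abs_apply_le_norm (A : Matrix μ ν ℝ) (i : μ) (j : ν) : |A i j| ≤ ‖A‖ := by
  have h := norm_toEuclideanLin_le A (EuclideanSpace.single j 1)
  have h2 := PiLp.norm_apply_le (Matrix.toEuclideanLin A (EuclideanSpace.single j (1 : ℝ))) i
  simp [Matrix.toLpLin_apply] at h h2
  exact h2.trans h

lemma norm_le_of_abs_apply_le (A : Matrix μ ν ℝ) {b : ℝ} (hb : 0 ≤ b)
    (h : ∀ i j, |A i j| ≤ b) : ‖A‖ ≤ Fintype.card μ * Fintype.card ν * b := by
  refine norm_le_of_forall_toEuclideanLin _ (by positivity) fun x => ?_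
  have h1 : ∀ i, ‖(A *ᵥ x.ofLp) i‖ ≤ Fintype.card ν * (b * ‖x‖) := fun i => by
    rw [Matrix.mulVec, dotProduct]
    refine (norm_sum_le _ _).trans ?_
    refine (Finset.sum_le_card_nsmul _ _ (b * ‖x‖) fun j _ => ?_).trans (by simp)
    rw [norm_mul]
    exact mul_le_mul (h i j) (PiLp.norm_apply_le x j) (norm_nonneg _) hb
  have h2 : ‖Matrix.toEuclideanLin A x‖ ≤ ∑ i, ‖(A *ᵥ x.ofLp) i‖ := by
    have h3 : Matrix.toEuclideanLin A x
        = ∑ i, EuclideanSpace.single i ((A *ᵥ x.ofLp) i) := by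
      ext i
      simp [Matrix.toLpLin_apply, Finset.sum_apply, Pi.single_apply]
    rw [h3]
    refine (norm_sum_le _ _).trans (le_of_eq ?_)
    simp
  refine h2.trans ((Finset.sum_le_card_nsmul _ _ _ fun i _ => h1 i).trans (le_of_eq ?_))
  simp
  ring

lemma norm_toLp_comp_le {f : ι → ν} (hf : Function.Injective f) (w : ν → ℝ) :
    ‖WithLp.toLp 2 (w ∘ f)‖ ≤ ‖WithLp.toLp 2 w‖ := by
  rw [EuclideanSpace.norm_eq, EuclideanSpace.norm_eq]
  refine Real.sqrt_le_sqrt ?_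
  have := Finset.sum_le_univ_sum_of_nonneg (s := Finset.univ.map ⟨f, hf⟩)
    (f := fun i => ‖w i‖ ^ 2) (fun i => by positivity)
  simpa using this

lemma norm_submatrix_le (A : Matrix μ ν ℝ) {f : ι → ν} (hf : Function.Injective f) :
    ‖A.submatrix id f‖ ≤ ‖A‖ := by
  rw [← norm_transpose, ← norm_transpose A]
  refine norm_le_of_forall_toEuclideanLin _ (norm_nonneg _) fun x => ?_
  refine le_trans ?_ (norm_toEuclideanLin_le Aᵀ x)
  exact norm_toLp_comp_le hf (Aᵀ *ᵥ x.ofLp)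

end Norms

/-! ### Extremal properties of singular values and the condition number -/

section SingularValues

variable {μ ν : Type*} [Fintype μ] [DecidableEq μ] [Fintype ν] [DecidableEq ν]

open Module in
lemma exists_norm_toEuclideanLin_eq (A : Matrix μ ν ℝ) {n : ℕ} (hn : n < Fintype.card ν) :
    ∃ x : EuclideanSpace ℝ ν, x ≠ 0 ∧
      ‖Matrix.toEuclideanLin A x‖ = (Matrix.toEuclideanLin A).singularValues n * ‖x‖ := by
  set T := Matrix.toEuclideanLin A
  obtain ⟨x, hx⟩ := (T.hasEigenvalue_adjoint_comp_self_sq_singularValues (n := n)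
    (by simpa using hn)).exists_hasEigenvector
  refine ⟨x, hx.2, ?_⟩
  have h1 : inner ℝ (LinearMap.adjoint T (T x)) x = inner ℝ (T x) (T x) :=
    LinearMap.adjoint_inner_left _ _ _
  have h2 : LinearMap.adjoint T (T x) = (T.singularValues n ^ 2) • x := hx.apply_eq_smul
  rw [h2, real_inner_smul_left, real_inner_self_eq_norm_sq, real_inner_self_eq_norm_sq] at h1
  have := T.singularValues_nonneg n
  rw [← sq_eq_sq₀ (norm_nonneg _) (by positivity), mul_pow, h1]

/-- The `y i` are the coordinates of `x` in an orthonormal eigenbasis of T*T. Bounding all weights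
by the smallest or the largest one gives both extremal inequalities. -/
lemma norm_sq_eq_sum_singularValues {E F : Type*} [NormedAddCommGroup E] [InnerProductSpace ℝ E]
    [FiniteDimensional ℝ E] [NormedAddCommGroup F] [InnerProductSpace ℝ F] [FiniteDimensional ℝ F]
    (T : E →ₗ[ℝ] F) {n : ℕ} (hn : Module.finrank ℝ E = n) (x : E) :
    ∃ y : Fin n → ℝ, ∑ i, y i ^ 2 = ‖x‖ ^ 2 ∧
      ‖T x‖ ^ 2 = ∑ i : Fin n, T.singularValues i ^ 2 * y i ^ 2 := by
  have hT := T.isSymmetric_adjoint_comp_self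
  refine ⟨fun i => inner ℝ (hT.eigenvectorBasis hn i) x, ?_, ?_⟩
  · simpa using (hT.eigenvectorBasis hn).sum_sq_norm_inner_right x
  · have h1 : inner ℝ ((LinearMap.adjoint T ∘ₗ T) x) x = inner ℝ (T x) (T x) := by
      rw [LinearMap.comp_apply, LinearMap.adjoint_inner_left]
    rw [real_inner_self_eq_norm_sq] at h1
    rw [← h1, ← (hT.eigenvectorBasis hn).sum_inner_mul_inner]
    refine Finset.sum_congr rfl fun i _ => ?_
    have h2 : inner ℝ ((LinearMap.adjoint T ∘ₗ T) x) (hT.eigenvectorBasis hn i)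
        = inner ℝ x ((LinearMap.adjoint T ∘ₗ T) (hT.eigenvectorBasis hn i)) := hT _ _
    have h3 := hT.apply_eigenvectorBasis hn i
    have h4 := T.sq_singularValues_fin hn i
    rw [h2, h3, h4, inner_smul_right, real_inner_comm _ x]
    simp only [RCLike.ofReal_real_eq_id, id_eq]
    ring

lemma sigmaMin_mul_norm_le (A : Matrix μ ν ℝ) (x : EuclideanSpace ℝ ν) :
    sigmaMin A * ‖x‖ ≤ ‖Matrix.toEuclideanLin A x‖ := by
  obtain ⟨y, hy, h⟩ := norm_sq_eq_sum_singularValues (Matrix.toEuclideanLin A)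
    finrank_euclideanSpace x
  have h0 : 0 ≤ sigmaMin A := LinearMap.singularValues_nonneg _ _
  rw [← sq_le_sq₀ (by positivity) (norm_nonneg _), h, mul_pow, ← hy, Finset.mul_sum]
  refine Finset.sum_le_sum fun i _ => ?_
  gcongr
  exact LinearMap.singularValues_antitone _ (by omega)

lemma norm_le_sigmaMax (A : Matrix μ ν ℝ) : ‖A‖ ≤ sigmaMax A := by
  have h0 : 0 ≤ sigmaMax A := LinearMap.singularValues_nonneg _ _
  refine norm_le_of_forall_toEuclideanLin _ h0 fun x => ?_
  obtain ⟨y, hy, h⟩ := norm_sq_eq_sum_singularValues (Matrix.toEuclideanLin A)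
    finrank_euclideanSpace x
  rw [← sq_le_sq₀ (norm_nonneg _) (by positivity), h, mul_pow, ← hy, Finset.mul_sum]
  refine Finset.sum_le_sum fun i _ => ?_
  gcongr
  · exact LinearMap.singularValues_nonneg _ _
  · exact LinearMap.singularValues_antitone _ (by omega)

lemma le_sigmaMin [Nonempty ν] (A : Matrix μ ν ℝ) {b : ℝ}
    (h : ∀ x, b * ‖x‖ ≤ ‖Matrix.toEuclideanLin A x‖) : b ≤ sigmaMin A := by
  obtain ⟨x, hx, he⟩ := exists_norm_toEuclideanLin_eq A (n := Fintype.card ν - 1)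
    (Nat.sub_lt Fintype.card_pos one_pos)
  exact le_of_mul_le_mul_right ((h x).trans he.le) (norm_pos_iff.2 hx)

lemma sigmaMax_eq_norm [Nonempty ν] (A : Matrix μ ν ℝ) : sigmaMax A = ‖A‖ := by
  refine le_antisymm ?_ (norm_le_sigmaMax A)
  obtain ⟨x, hx, he⟩ := exists_norm_toEuclideanLin_eq A (n := 0) Fintype.card_pos
  exact le_of_mul_le_mul_right (he.symm.le.trans (norm_toEuclideanLin_le A x)) (norm_pos_iff.2 hx)

lemma sigmaMin_le_norm [Nonempty ν] (A : Matrix μ ν ℝ) : sigmaMin A ≤ ‖A‖ := by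
  rw [← sigmaMax_eq_norm]
  exact LinearMap.singularValues_antitone _ (Nat.zero_le _)

lemma one_le_kappa [Nonempty ν] (A : Matrix μ ν ℝ) (h : 0 < sigmaMin A) : 1 ≤ kappa A := by
  rw [kappa, one_le_div h, sigmaMax_eq_norm]
  exact sigmaMin_le_norm A

end SingularValues

/-! ### Rounding errors of sums and matrix operations -/

section Rounding

lemma one_add_pow_sub_one_le {ε : ℝ} (h0 : 0 ≤ ε) (h1 : ε ≤ 1) (n : ℕ) :
    (1 + ε) ^ n - 1 ≤ 2 ^ n * ε := by
  -- The factor 2^n - 1 makes the induction close: (2^n - 1) · 2 + 1 = 2^(n+1) - 1.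
  suffices h : (1 + ε) ^ n - 1 ≤ (2 ^ n - 1) * ε by linarith
  induction n with
  | zero => simp
  | succ n ih =>
    have h2 : (1 : ℝ) ≤ 2 ^ n := one_le_pow₀ one_le_two
    have h3 : (2 ^ n - 1) * ε * (1 + ε) ≤ (2 ^ n - 1) * ε * 2 :=
      mul_le_mul_of_nonneg_left (by linarith) (mul_nonneg (by linarith) h0)
    have h4 := mul_le_mul_of_nonneg_right ih (show 0 ≤ 1 + ε by linarith)
    rw [pow_succ, pow_succ]
    linarith

lemma RoundedSum.card_pos {ε : ℝ} {t : Multiset ℝ} {z : ℝ} (h : RoundedSum ε t z) :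
    0 < t.card := by
  induction h with
  | single x => simp
  | add _ _ _ iha _ => rw [Multiset.card_add]; omega

lemma Rounded.abs_sub_le {ε x y : ℝ} (h : Rounded ε x y) : |y - x| ≤ ε * |x| := by
  obtain ⟨δ, hδ, rfl⟩ := h
  rw [show x * (1 + δ) - x = δ * x by ring, abs_mul]
  exact mul_le_mul_of_nonneg_right hδ (abs_nonneg _)

/-- Each addition multiplies the error factor of the leaves below it by at most 1 + ε. The other
subtree is nonempty, so the number of leaves grows at least as fast as the exponent, whatever the
tree. -/
lemma RoundedSum.abs_sub_sum_le {ε : ℝ} (hε : 0 ≤ ε) {t : Multiset ℝ} {z : ℝ}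
    (h : RoundedSum ε t z) :
    |z - t.sum| ≤ ((1 + ε) ^ t.card - 1) * (t.map abs).sum := by
  induction h with
  | single x => simp; positivity
  | @add t u a b c ha hb hc iha ihb =>
    have hn := ha.card_pos
    have hk := hb.card_pos
    rw [Multiset.card_add, Multiset.map_add, Multiset.sum_add, Multiset.sum_add]
    have hs : ∀ w : Multiset ℝ, |w.sum| ≤ (w.map abs).sum := fun w => Multiset.abs_sum_le_sum_abs
    have ht := hs t
    have hu := hs u
    have hT := (abs_nonneg _).trans ht
    have hU := (abs_nonneg _).trans hu
    have h1 := hc.abs_sub_le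
    set T := (t.map abs).sum
    set U := (u.map abs).sum
    have h2 : |a| ≤ (1 + ε) ^ t.card * T := by
      have := abs_add_le (a - t.sum) t.sum
      rw [sub_add_cancel] at this
      linarith
    have h3 : |b| ≤ (1 + ε) ^ u.card * U := by
      have := abs_add_le (b - u.sum) u.sum
      rw [sub_add_cancel] at this
      linarith
    have h4 : |a + b| ≤ (1 + ε) ^ t.card * T + (1 + ε) ^ u.card * U :=
      (abs_add_le a b).trans (add_le_add h2 h3)
    have h5 : |c - (t.sum + u.sum)| ≤ |c - (a + b)| + (|a - t.sum| + |b - u.sum|) := by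
      rw [show c - (t.sum + u.sum) = (c - (a + b)) + ((a - t.sum) + (b - u.sum)) by ring]
      exact (abs_add_le _ _).trans (add_le_add le_rfl (abs_add_le _ _))
    have h6 := mul_le_mul_of_nonneg_left h4 hε
    have h7 : (1 + ε) ^ (t.card + 1) * T ≤ (1 + ε) ^ (t.card + u.card) * T :=
      mul_le_mul_of_nonneg_right (pow_le_pow_right₀ (by linarith) (by omega)) hT
    have h8 : (1 + ε) ^ (u.card + 1) * U ≤ (1 + ε) ^ (t.card + u.card) * U :=
      mul_le_mul_of_nonneg_right (pow_le_pow_right₀ (by linarith) (by omega)) hU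
    rw [pow_succ] at h7 h8
    linarith

variable {μ ι ν : Type*} [Fintype μ] [DecidableEq μ] [Fintype ι] [DecidableEq ι]
  [Fintype ν] [DecidableEq ν]

lemma abs_sum_sub_sum_le {ε : ℝ} {x q : ι → ℝ} (h : ∀ l, Rounded ε (x l) (q l)) :
    |∑ l, q l - ∑ l, x l| ≤ ε * ∑ l, |x l| := by
  rw [← Finset.sum_sub_distrib, Finset.mul_sum]
  exact (Finset.abs_sum_le_sum_abs _ _).trans (Finset.sum_le_sum fun l _ => (h l).abs_sub_le)

lemma sum_abs_le_of_rounded {ε : ℝ} {x q : ι → ℝ} (h : ∀ l, Rounded ε (x l) (q l)) :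
    ∑ l, |q l| ≤ (1 + ε) * ∑ l, |x l| := by
  rw [Finset.mul_sum]
  refine Finset.sum_le_sum fun l _ => ?_
  have := abs_add_le (q l - x l) (x l)
  rw [sub_add_cancel] at this
  linarith [(h l).abs_sub_le]

/-- The exponent counts one rounding for each product and `card ι` for the summation. In
`ComputedSubMul.abs_sub_le` the term `D i j` is one more leaf. -/
lemma ComputedMul.abs_sub_le {ε : ℝ} (h0 : 0 ≤ ε) (h1 : ε ≤ 1) {A : Matrix μ ι ℝ}
    {B : Matrix ι ν ℝ} {C : Matrix μ ν ℝ} (h : ComputedMul ε A B C) (i : μ) (j : ν) :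
    |(C - A * B) i j| ≤ 2 ^ (Fintype.card ι + 1) * ε * ∑ l, |A i l * B l j| := by
  obtain ⟨q, hq, hC⟩ := h i j
  have h2 := hC.abs_sub_sum_le h0
  have h3 := abs_sum_sub_sum_le hq
  have h4 := sum_abs_le_of_rounded hq
  have h5 := one_add_pow_sub_one_le h0 h1 (Fintype.card ι + 1)
  simp only [Multiset.map_map, Multiset.card_map, Finset.card_val, Finset.card_univ,
    Function.comp_def, Finset.sum_map_val] at h2
  have hS : 0 ≤ ∑ l, |A i l * B l j| := Finset.sum_nonneg fun _ _ => abs_nonneg _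
  have h6 : 0 ≤ (1 + ε) ^ Fintype.card ι - 1 := by
    linarith [one_le_pow₀ (n := Fintype.card ι) (show 1 ≤ 1 + ε by linarith)]
  rw [Matrix.sub_apply, Matrix.mul_apply]
  have h7 := _root_.abs_sub_le (C i j) (∑ l, q l) (∑ l, A i l * B l j)
  have h8 := mul_le_mul_of_nonneg_left h4 h6
  have h9 := mul_le_mul_of_nonneg_right h5 hS
  rw [pow_succ] at h9
  linarith

lemma ComputedSubMul.abs_sub_le {ε : ℝ} (h0 : 0 ≤ ε) (h1 : ε ≤ 1) {D : Matrix μ ν ℝ}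
    {A : Matrix μ ι ℝ} {B : Matrix ι ν ℝ} {C : Matrix μ ν ℝ} (h : ComputedSubMul ε D A B C)
    (i : μ) (j : ν) :
    |(C - (D - A * B)) i j|
      ≤ 2 ^ (Fintype.card ι + 2) * ε * (|D i j| + ∑ l, |A i l * B l j|) := by
  obtain ⟨q, hq, hC⟩ := h i j
  have h2 := hC.abs_sub_sum_le h0
  have h3 := abs_sum_sub_sum_le hq
  have h4 := sum_abs_le_of_rounded hq
  have h5 := one_add_pow_sub_one_le h0 h1 (Fintype.card ι + 2)
  simp only [Multiset.map_map, Multiset.card_map, Finset.card_val, Finset.card_univ,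
    Function.comp_def, Finset.sum_map_val, Multiset.card_cons, Multiset.map_cons,
    Multiset.sum_cons, abs_neg, Finset.sum_neg_distrib] at h2
  have hS : 0 ≤ ∑ l, |A i l * B l j| := Finset.sum_nonneg fun _ _ => abs_nonneg _
  have hD : 0 ≤ |D i j| := abs_nonneg _
  have h6 : 0 ≤ (1 + ε) ^ (Fintype.card ι + 1) - 1 := by
    linarith [one_le_pow₀ (n := Fintype.card ι + 1) (show 1 ≤ 1 + ε by linarith)]
  rw [Matrix.sub_apply, Matrix.sub_apply, Matrix.mul_apply]
  have h7 := _root_.abs_sub_le (C i j) (D i j + -∑ l, q l) (D i j - ∑ l, A i l * B l j)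
  rw [show D i j + -∑ l, q l - (D i j - ∑ l, A i l * B l j)
    = -(∑ l, q l - ∑ l, A i l * B l j) by ring, abs_neg] at h7
  have h8 := mul_le_mul_of_nonneg_left h4 h6
  have h9 := mul_le_mul_of_nonneg_right h5 (add_nonneg hD hS)
  have h10 : (1 + ε) ^ (Fintype.card ι + 1) * |D i j|
      ≤ (1 + ε) ^ (Fintype.card ι + 2) * |D i j| :=
    mul_le_mul_of_nonneg_right (pow_le_pow_right₀ (by linarith) (by omega)) hD
  rw [pow_succ _ (Fintype.card ι + 1)] at h9 h10
  linarith

/-- A crude factor for the passage from entrywise to normwise rounding errors, for matrices with at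
most `n` rows and columns. -/
noncomputable def roundingFactor (n : ℕ) : ℝ := (n : ℝ) ^ 3 * 2 ^ (n + 2)

lemma sum_abs_mul_le (A : Matrix μ ι ℝ) (B : Matrix ι ν ℝ) (i : μ) (j : ν) :
    ∑ l, |A i l * B l j| ≤ Fintype.card ι * (‖A‖ * ‖B‖) := by
  refine (Finset.sum_le_card_nsmul _ _ (‖A‖ * ‖B‖) fun l _ => ?_).trans (by simp)
  rw [abs_mul]
  exact mul_le_mul (abs_apply_le_norm A i l) (abs_apply_le_norm B l j) (abs_nonneg _)
    (norm_nonneg _)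

lemma norm_le_roundingFactor_mul {n : ℕ} (hn : 0 < n) (hμ : Fintype.card μ ≤ n)
    (hν : Fintype.card ν ≤ n) (A : Matrix μ ν ℝ) {b : ℝ} (hb : 0 ≤ b)
    (h : ∀ i j, |A i j| ≤ n * 2 ^ (n + 2) * b) : ‖A‖ ≤ roundingFactor n * b := by
  refine (norm_le_of_abs_apply_le A (by positivity) h).trans ?_
  have : ((Fintype.card μ : ℝ) * Fintype.card ν) ≤ n * n := by gcongr
  calc _ ≤ ((n : ℝ) * n) * (n * 2 ^ (n + 2) * b) := by gcongr
    _ = _ := by rw [roundingFactor]; ring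

lemma one_le_natCast_mul_two_pow {n : ℕ} (hn : 0 < n) : (1 : ℝ) ≤ n * 2 ^ (n + 2) :=
  one_le_mul_of_one_le_of_one_le (by exact_mod_cast hn) (one_le_pow₀ one_le_two)

lemma one_le_roundingFactor {n : ℕ} (hn : 0 < n) : 1 ≤ roundingFactor n :=
  one_le_mul_of_one_le_of_one_le (one_le_pow₀ (by exact_mod_cast hn)) (one_le_pow₀ one_le_two)

lemma norm_le_roundingFactor_mul' {n : ℕ} (hn : 0 < n) (hμ : Fintype.card μ ≤ n)
    (hν : Fintype.card ν ≤ n) (A : Matrix μ ν ℝ) {b : ℝ} (hb : 0 ≤ b)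
    (h : ∀ i j, |A i j| ≤ b) : ‖A‖ ≤ roundingFactor n * b :=
  norm_le_roundingFactor_mul hn hμ hν A hb fun i j =>
    (h i j).trans (le_mul_of_one_le_left hb (one_le_natCast_mul_two_pow hn))

lemma ComputedMul.norm_sub_le {n : ℕ} (hn : 0 < n) (hμ : Fintype.card μ ≤ n)
    (hι : Fintype.card ι ≤ n) (hν : Fintype.card ν ≤ n) {ε : ℝ} (h0 : 0 ≤ ε) (h1 : ε ≤ 1)
    {A : Matrix μ ι ℝ} {B : Matrix ι ν ℝ} {C : Matrix μ ν ℝ} (h : ComputedMul ε A B C) :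
    ‖C - A * B‖ ≤ roundingFactor n * ε * (‖A‖ * ‖B‖) := by
  rw [mul_assoc]
  refine norm_le_roundingFactor_mul hn hμ hν _ (by positivity) fun i j => ?_
  have h2 := sum_abs_mul_le A B i j
  calc _ ≤ _ := h.abs_sub_le h0 h1 i j
    _ ≤ 2 ^ (n + 2) * ε * (n * (‖A‖ * ‖B‖)) := by
      gcongr
      · exact one_le_two
      · omega
      · exact h2.trans (by gcongr)
    _ = _ := by ring

lemma ComputedSubMul.norm_sub_le {n : ℕ} (hn : 0 < n) (hμ : Fintype.card μ ≤ n)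
    (hι : Fintype.card ι ≤ n) (hν : Fintype.card ν ≤ n) {ε : ℝ} (h0 : 0 ≤ ε) (h1 : ε ≤ 1)
    {D : Matrix μ ν ℝ} {A : Matrix μ ι ℝ} {B : Matrix ι ν ℝ} {C : Matrix μ ν ℝ}
    (h : ComputedSubMul ε D A B C) :
    ‖C - (D - A * B)‖ ≤ roundingFactor n * ε * (‖D‖ + ‖A‖ * ‖B‖) := by
  rw [mul_assoc]
  refine norm_le_roundingFactor_mul hn hμ hν _ (by positivity) fun i j => ?_
  have h2 := sum_abs_mul_le A B i j
  have h3 : |D i j| + ∑ l, |A i l * B l j| ≤ n * (‖D‖ + ‖A‖ * ‖B‖) := by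
    rw [mul_add]
    refine add_le_add ?_ (h2.trans (by gcongr))
    exact (abs_apply_le_norm D i j).trans
      (le_mul_of_one_le_left (norm_nonneg _) (by exact_mod_cast hn))
  calc _ ≤ _ := h.abs_sub_le h0 h1 i j
    _ ≤ 2 ^ (n + 2) * ε * (n * (‖D‖ + ‖A‖ * ‖B‖)) := by
      gcongr
      exact one_le_two
    _ = _ := by ring

lemma ComputedAdd.norm_sub_le {n : ℕ} (hn : 0 < n) (hμ : Fintype.card μ ≤ n)
    (hν : Fintype.card ν ≤ n) {ε : ℝ} (h0 : 0 ≤ ε) {A B C : Matrix μ ν ℝ}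
    (h : ComputedAdd ε A B C) : ‖C - (A + B)‖ ≤ roundingFactor n * ε * (‖A‖ + ‖B‖) := by
  rw [mul_assoc]
  refine norm_le_roundingFactor_mul' hn hμ hν _ (by positivity) fun i j => ?_
  refine (h i j).abs_sub_le.trans (mul_le_mul_of_nonneg_left ?_ h0)
  exact (abs_add_le _ _).trans (add_le_add (abs_apply_le_norm A i j) (abs_apply_le_norm B i j))

end Rounding

/-! ### One and two projections with a nearly orthonormal basis -/

section ProjectionStep

variable {μ ι ν : Type*} [Fintype μ] [DecidableEq μ] [Fintype ι] [DecidableEq ι]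
  [Fintype ν] [DecidableEq ν]

lemma inner_toEuclideanLin_left (A : Matrix μ ν ℝ) (x : EuclideanSpace ℝ ν)
    (y : EuclideanSpace ℝ μ) :
    inner ℝ (Matrix.toEuclideanLin A x) y = inner ℝ x (Matrix.toEuclideanLin Aᵀ y) := by
  rw [← Matrix.conjTranspose_eq_transpose_of_trivial,
    Matrix.toEuclideanLin_conjTranspose_eq_adjoint, LinearMap.adjoint_inner_right]

lemma toEuclideanLin_one_apply (x : EuclideanSpace ℝ ν) :
    Matrix.toEuclideanLin (1 : Matrix ν ν ℝ) x = x := by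
  simp

/-- With w = Qᵀz, ‖z - Qw‖² = ‖z‖² - 2‖w‖² + ‖Qw‖² and ‖Qw‖² ≤ 2‖w‖². The constant is exactly 1,
which allows τ to be arbitrarily close to 1 in κ(W) ≤ τκ. -/
lemma norm_one_sub_mul_transpose_le {Q : Matrix μ ι ℝ} (h : ‖1 - Qᵀ * Q‖ ≤ 1) :
    ‖1 - Q * Qᵀ‖ ≤ 1 := by
  refine norm_le_of_forall_toEuclideanLin _ zero_le_one fun z => ?_
  rw [one_mul, map_sub, LinearMap.sub_apply, toEuclideanLin_mul_apply, toEuclideanLin_one_apply]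
  set w := Matrix.toEuclideanLin Qᵀ z with hw
  have h1 : inner ℝ z (Matrix.toEuclideanLin Q w) = ‖w‖ ^ 2 := by
    rw [real_inner_comm, inner_toEuclideanLin_left, ← hw, real_inner_self_eq_norm_sq]
  have h2 : ‖Matrix.toEuclideanLin Q w‖ ^ 2
      = ‖w‖ ^ 2 - inner ℝ w (Matrix.toEuclideanLin (1 - Qᵀ * Q) w) := by
    rw [← real_inner_self_eq_norm_sq, inner_toEuclideanLin_left, map_sub, LinearMap.sub_apply,
      toEuclideanLin_mul_apply, toEuclideanLin_one_apply, inner_sub_right,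
      real_inner_self_eq_norm_sq]
    ring
  have h3 : |inner ℝ w (Matrix.toEuclideanLin (1 - Qᵀ * Q) w)| ≤ ‖w‖ * ‖w‖ := by
    refine (abs_real_inner_le_norm _ _).trans (mul_le_mul_of_nonneg_left ?_ (norm_nonneg _))
    exact (norm_toEuclideanLin_le _ _).trans (mul_le_of_le_one_left (norm_nonneg _) h)
  rw [← sq_le_sq₀ (norm_nonneg _) (norm_nonneg _), norm_sub_sq_real, h1, h2]
  linarith [(abs_le.1 h3).1]

lemma norm_le_two_of_norm_one_sub_le {Q : Matrix μ ι ℝ} (h : ‖1 - Qᵀ * Q‖ ≤ 1) : ‖Q‖ ≤ 2 := by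
  have h1 : ‖Qᵀ * Q‖ ≤ 2 := by
    have := norm_sub_le (1 : Matrix ι ι ℝ) (1 - Qᵀ * Q)
    rw [sub_sub_cancel] at this
    linarith [norm_one_le (ν := ι)]
  rw [norm_transpose_mul_self] at h1
  nlinarith [norm_nonneg Q]

lemma norm_mul_le_of_le {A : Matrix μ ι ℝ} {B : Matrix ι ν ℝ} {a b : ℝ} (hA : ‖A‖ ≤ a)
    (hB : ‖B‖ ≤ b) : ‖A * B‖ ≤ a * b :=
  (Matrix.l2_opNorm_mul A B).trans
    (mul_le_mul hA hB (norm_nonneg _) ((norm_nonneg _).trans hA))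

/-- The effect of one application of the computed projector `X ↦ X - Q Qᵀ X`. -/
lemma norm_projection_step {Q : Matrix μ ι ℝ} {X V : Matrix μ ν ℝ} {S : Matrix ι ν ℝ}
    {h N : ℝ} (hQ : ‖1 - Qᵀ * Q‖ ≤ 1) (hX : ‖X‖ ≤ N) (h0 : 0 ≤ h) (h1 : h ≤ 1 / 40)
    (hS : ‖S - Qᵀ * X‖ ≤ h * (‖Qᵀ‖ * ‖X‖)) (hV : ‖V - (X - Q * S)‖ ≤ h * (‖X‖ + ‖Q‖ * ‖S‖)) :
    ‖S‖ ≤ 3 * N ∧ ‖V - (X - Q * S)‖ ≤ 7 * h * N ∧ ‖V - (1 - Q * Qᵀ) * X‖ ≤ 11 * h * N ∧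
      ‖V‖ ≤ (1 + 11 * h) * N := by
  have hQ2 := norm_le_two_of_norm_one_sub_le hQ
  have hN : 0 ≤ N := (norm_nonneg X).trans hX
  rw [norm_transpose] at hS
  have hS1 : ‖S - Qᵀ * X‖ ≤ h * (2 * N) := hS.trans (by gcongr)
  have hhN : h * N ≤ 1 / 40 * N := by gcongr
  have hS2 : ‖S‖ ≤ 3 * N := by
    have h2 : ‖Qᵀ * X‖ ≤ 2 * N := norm_mul_le_of_le (by rwa [norm_transpose]) hX
    have h3 := norm_add_le (S - Qᵀ * X) (Qᵀ * X)
    rw [sub_add_cancel] at h3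
    linarith
  have hV1 : ‖V - (X - Q * S)‖ ≤ h * (N + 2 * (3 * N)) := hV.trans (by gcongr)
  have hV2 : ‖V - (1 - Q * Qᵀ) * X‖ ≤ 11 * h * N := by
    have h2 : V - (1 - Q * Qᵀ) * X = (V - (X - Q * S)) - Q * (S - Qᵀ * X) := by
      simp only [Matrix.mul_sub, Matrix.sub_mul, Matrix.mul_assoc, Matrix.one_mul]
      abel
    have h3 : ‖Q * (S - Qᵀ * X)‖ ≤ 2 * (h * (2 * N)) := norm_mul_le_of_le hQ2 hS1
    rw [h2]
    linarith [norm_sub_le (V - (X - Q * S)) (Q * (S - Qᵀ * X))]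
  refine ⟨hS2, by linarith, hV2, ?_⟩
  have h2 : ‖(1 - Q * Qᵀ) * X‖ ≤ 1 * N :=
    norm_mul_le_of_le (norm_one_sub_mul_transpose_le hQ) hX
  have h3 := norm_add_le (V - (1 - Q * Qᵀ) * X) ((1 - Q * Qᵀ) * X)
  rw [sub_add_cancel] at h3
  linarith

/-- In Q T + W - X the exact parts cancel and only the local errors of `V`, `W` and `T` remain; the
defect 1 - QᵀQ enters only through ‖Q‖ ≤ 2. -/
lemma norm_two_projection_steps {Q : Matrix μ ι ℝ} {X V W : Matrix μ ν ℝ} {S Y T : Matrix ι ν ℝ}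
    {h N : ℝ} (hQ : ‖1 - Qᵀ * Q‖ ≤ 1) (hX : ‖X‖ ≤ N) (h0 : 0 ≤ h) (h1 : h ≤ 1 / 40)
    (hS : ‖S - Qᵀ * X‖ ≤ h * (‖Qᵀ‖ * ‖X‖)) (hV : ‖V - (X - Q * S)‖ ≤ h * (‖X‖ + ‖Q‖ * ‖S‖))
    (hY : ‖Y - Qᵀ * V‖ ≤ h * (‖Qᵀ‖ * ‖V‖)) (hW : ‖W - (V - Q * Y)‖ ≤ h * (‖V‖ + ‖Q‖ * ‖Y‖))
    (hT : ‖T - (S + Y)‖ ≤ h * (‖S‖ + ‖Y‖)) :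
    ‖V - (1 - Q * Qᵀ) * X‖ ≤ 22 * h * N ∧ ‖W - (1 - Q * Qᵀ) * V‖ ≤ 22 * h * N ∧
      ‖W‖ ≤ (1 + 60 * h) * N ∧ ‖Q * T + W - X‖ ≤ 60 * h * N := by
  obtain ⟨hS1, hV1, hV2, hV3⟩ := norm_projection_step hQ hX h0 h1 hS hV
  -- The second pass has (1 + 11h)N in the role of N; h ≤ 1/40 absorbs the terms in h².
  obtain ⟨hY1, hW1, hW2, hW3⟩ := norm_projection_step hQ hV3 h0 h1 hY hW
  have hN : 0 ≤ N := (norm_nonneg X).trans hX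
  have hhN : 0 ≤ h * N := by positivity
  have hhhN : h * (h * N) ≤ 1 / 40 * (h * N) := by gcongr
  have hT1 : ‖T - (S + Y)‖ ≤ h * (3 * N + 3 * ((1 + 11 * h) * N)) := hT.trans (by gcongr)
  have hQT := norm_mul_le_of_le (norm_le_two_of_norm_one_sub_le hQ) hT1
  refine ⟨by linarith, by linarith, by linarith, ?_⟩
  have h2 : Q * T + W - X
      = Q * (T - (S + Y)) + ((V - (X - Q * S)) + (W - (V - Q * Y))) := by
    simp only [Matrix.mul_sub, Matrix.mul_add]
    abel
  rw [h2]
  linarith [norm_add_le (Q * (T - (S + Y))) ((V - (X - Q * S)) + (W - (V - Q * Y))),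
    norm_add_le (V - (X - Q * S)) (W - (V - Q * Y))]

lemma exists_toEuclideanLin_eq {R : Matrix ι ι ℝ} {Z : Matrix μ ι ℝ} {Q : Matrix μ ι ℝ} {b : ℝ}
    (hb : 0 < b) (hZ : Z = Q * R) (h : ∀ u, b * ‖u‖ ≤ ‖Matrix.toEuclideanLin Z u‖)
    (v : EuclideanSpace ℝ ι) : ∃ u, Matrix.toEuclideanLin R u = v := by
  refine LinearMap.injective_iff_surjective.1 ?_ v
  rw [← LinearMap.ker_eq_bot, LinearMap.ker_eq_bot']
  intro u hu
  have h1 := h u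
  rw [hZ, toEuclideanLin_mul_apply, hu, map_zero, norm_zero] at h1
  have h2 := norm_nonneg u
  exact norm_eq_zero.1 (le_antisymm (nonpos_of_mul_nonpos_right h1 hb) h2)

/-- The orthogonalized block inherits a lower bound for its singular values from the
matrix `[A B]`. -/
lemma lower_bound_of_residual {A Q : Matrix μ ι ℝ} {B W : Matrix μ ν ℝ} {R : Matrix ι ι ℝ}
    {T : Matrix ι ν ℝ} {σ d f : ℝ}
    (hu : ∀ u v, σ * ‖u‖ ≤ ‖Matrix.toEuclideanLin A u + Matrix.toEuclideanLin B v‖)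
    (hv : ∀ u v, σ * ‖v‖ ≤ ‖Matrix.toEuclideanLin A u + Matrix.toEuclideanLin B v‖)
    (hd : ‖Q * R - A‖ ≤ d) (hdσ : d < σ) (hf : ‖Q * T + W - B‖ ≤ f) (v : EuclideanSpace ℝ ν) :
    (σ - d - f) * ‖v‖ ≤ ‖Matrix.toEuclideanLin W v‖ := by
  have hd0 : 0 ≤ d := (norm_nonneg _).trans hd
  have hD : ∀ u, ‖Matrix.toEuclideanLin (Q * R - A) u‖ ≤ d * ‖u‖ := fun u =>
    (norm_toEuclideanLin_le _ _).trans (mul_le_mul_of_nonneg_right hd (norm_nonneg _))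
  -- Choose u with R u = T v, so that Q R u and Q T v cancel in B v - A u. Such u exists because QR
  -- is within d < σ of A, hence injective, and R is square.
  obtain ⟨u, hu'⟩ := exists_toEuclideanLin_eq (sub_pos.2 hdσ) (rfl : Q * R = Q * R) (fun u => by
    have h1 := hu u 0
    rw [map_zero, add_zero] at h1
    have h2 := norm_sub_norm_le (Matrix.toEuclideanLin A u) (-Matrix.toEuclideanLin (Q * R - A) u)
    rw [norm_neg, sub_neg_eq_add, map_sub, LinearMap.sub_apply, add_sub_cancel] at h2
    have h3 := hD u
    rw [map_sub, LinearMap.sub_apply] at h3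
    linarith) (Matrix.toEuclideanLin T v)
  have h1 := hu (-u) v
  have h2 := hv (-u) v
  rw [norm_neg] at h1
  set z := Matrix.toEuclideanLin A (-u) + Matrix.toEuclideanLin B v with hz
  have h3 : z = Matrix.toEuclideanLin W v + (Matrix.toEuclideanLin (Q * R - A) u
      - Matrix.toEuclideanLin (Q * T + W - B) v) := by
    simp only [hz, map_sub, map_add, map_neg, LinearMap.sub_apply, LinearMap.add_apply,
      toEuclideanLin_mul_apply, hu']
    abel
  have h4 : ‖z‖ ≤ ‖Matrix.toEuclideanLin W v‖ + (d * ‖u‖ + f * ‖v‖) := by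
    rw [h3]
    refine (norm_add_le _ _).trans (add_le_add le_rfl ((norm_sub_le _ _).trans
      (add_le_add (hD u) ((norm_toEuclideanLin_le _ _).trans ?_))))
    exact mul_le_mul_of_nonneg_right hf (norm_nonneg _)
  -- No bound of u by v is needed: d times the bound σ‖u‖ ≤ ‖z‖ plus σ - d times the bound σ‖v‖ ≤
  -- ‖z‖ yields the claim.
  have h5 : (σ - d) * ‖v‖ ≤ ‖z‖ - d * ‖u‖ := by
    have hσ : 0 < σ := hd0.trans_lt hdσ
    refine le_of_mul_le_mul_left ?_ hσ
    have h6 := mul_le_mul_of_nonneg_left h1 hd0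
    have h7 := mul_le_mul_of_nonneg_left h2 (sub_nonneg.2 hdσ.le)
    linarith
  linarith

/-- Qᵀ(1 - QQᵀ) = (1 - QᵀQ)Qᵀ, so each projection contributes one factor ω; this is where
reorthogonalization pays off. -/
lemma norm_transpose_mul_le_of_two_steps {Q : Matrix μ ι ℝ} {X V W Z : Matrix μ ν ℝ}
    {N e f ω : ℝ} (hω : ω ≤ 1) (hQ : ‖1 - Qᵀ * Q‖ ≤ ω) (hX : ‖X‖ ≤ N)
    (hV : ‖V - (1 - Q * Qᵀ) * X‖ ≤ f) (hW : ‖W - (1 - Q * Qᵀ) * V‖ ≤ f) (hZ : ‖Z - W‖ ≤ e) :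
    ‖Qᵀ * Z‖ ≤ 2 * ω ^ 2 * N + 4 * f + 2 * e := by
  have hQ2 : ‖Qᵀ‖ ≤ 2 := by
    rw [norm_transpose]
    exact norm_le_two_of_norm_one_sub_le (hQ.trans hω)
  have hω0 : 0 ≤ ω := (norm_nonneg _).trans hQ
  have hf0 : 0 ≤ f := (norm_nonneg _).trans hV
  have h1 : Qᵀ * Z = (1 - Qᵀ * Q) * ((1 - Qᵀ * Q) * (Qᵀ * X))
      + ((1 - Qᵀ * Q) * (Qᵀ * (V - (1 - Q * Qᵀ) * X))
      + (Qᵀ * (W - (1 - Q * Qᵀ) * V) + Qᵀ * (Z - W))) := by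
    simp only [Matrix.mul_sub, Matrix.sub_mul, Matrix.mul_assoc, Matrix.one_mul]
    abel
  have a1 := norm_mul_le_of_le hQ (norm_mul_le_of_le hQ (norm_mul_le_of_le hQ2 hX))
  have a2 := norm_mul_le_of_le hQ (norm_mul_le_of_le hQ2 hV)
  have a3 := norm_mul_le_of_le hQ2 hW
  have a4 := norm_mul_le_of_le hQ2 hZ
  have a5 : ω * (2 * f) ≤ 1 * (2 * f) := by gcongr
  rw [h1]
  refine (norm_add_le _ _).trans ?_
  refine (add_le_add a1 ((norm_add_le _ _).trans (add_le_add a2 ((norm_add_le _ _).trans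
    (add_le_add a3 a4))))).trans ?_
  linarith

/-- R is invertible and A Q = (A Z)R⁻¹, where b‖u‖ ≤ ‖Q R u‖ ≤ 2‖R u‖ gives ‖R⁻¹‖ ≤ 2/b. -/
lemma norm_mul_le_of_factorization {A : Matrix ι μ ℝ} {Q Z : Matrix μ ν ℝ} {R : Matrix ν ν ℝ}
    {b c : ℝ} (hb : 0 < b) (hZ : Z = Q * R) (h : ∀ u, b * ‖u‖ ≤ ‖Matrix.toEuclideanLin Z u‖)
    (hQ : ‖Q‖ ≤ 2) (hA : ‖A * Z‖ ≤ c) : ‖A * Q‖ ≤ 2 * c / b := by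
  have hc : 0 ≤ c := (norm_nonneg _).trans hA
  refine norm_le_of_forall_toEuclideanLin _ (by positivity) fun v => ?_
  obtain ⟨u, rfl⟩ := exists_toEuclideanLin_eq hb hZ h v
  set v := Matrix.toEuclideanLin R u with hv
  have h1 : Matrix.toEuclideanLin (A * Q) v = Matrix.toEuclideanLin (A * Z) u := by
    rw [hZ, hv, ← Matrix.mul_assoc, toEuclideanLin_mul_apply (A * Q)]
  have h2 : b * ‖u‖ ≤ 2 * ‖v‖ := by
    refine (h u).trans ?_
    rw [hZ, toEuclideanLin_mul_apply, ← hv]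
    exact (norm_toEuclideanLin_le _ _).trans (mul_le_mul_of_nonneg_right hQ (norm_nonneg _))
  rw [h1]
  calc _ ≤ c * ‖u‖ := (norm_toEuclideanLin_le _ _).trans
        (mul_le_mul_of_nonneg_right hA (norm_nonneg _))
    _ ≤ c * (2 * ‖v‖ / b) := by
        gcongr
        rw [le_div_iff₀ hb]
        linarith
    _ = _ := by ring

end ProjectionStep

/-! ### Orthogonalization of one block -/

section OrthogonalizationStep

variable {μ ι ν : Type*} [Fintype μ] [DecidableEq μ] [Fintype ι] [DecidableEq ι]
  [Fintype ν] [DecidableEq ν]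

/-- Residual, orthogonality and block coupling after the orthogonalization of the block `B` against
the nearly orthonormal columns of `Q`, where `Q * R` is close to `A`. -/
theorem orthogonalization_step [Nonempty ν] {A Q : Matrix μ ι ℝ} {B V W Q' : Matrix μ ν ℝ}
    {S Y T : Matrix ι ν ℝ} {R : Matrix ι ι ℝ} {R' : Matrix ν ν ℝ}
    {N σ h η d x τ ω α β : ℝ} (hσ : 0 < σ) (hσN : σ ≤ N) (h0 : 0 ≤ h) (hη : 0 ≤ η)
    (hx : x ≤ 1 / 2) (hxτ : 1 + x ≤ τ * (1 - x)) (hh : h ≤ 1 / 60) (hω : ω ≤ 1)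
    (hαβ : α ≤ β) (hβ : 0 ≤ β)
    (hu : ∀ u v, σ * ‖u‖ ≤ ‖Matrix.toEuclideanLin A u + Matrix.toEuclideanLin B v‖)
    (hv : ∀ u v, σ * ‖v‖ ≤ ‖Matrix.toEuclideanLin A u + Matrix.toEuclideanLin B v‖)
    (hQ : ‖1 - Qᵀ * Q‖ ≤ ω) (hB : ‖B‖ ≤ N)
    (hS : ‖S - Qᵀ * B‖ ≤ h * (‖Qᵀ‖ * ‖B‖)) (hV : ‖V - (B - Q * S)‖ ≤ h * (‖B‖ + ‖Q‖ * ‖S‖))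
    (hY : ‖Y - Qᵀ * V‖ ≤ h * (‖Qᵀ‖ * ‖V‖)) (hW : ‖W - (V - Q * Y)‖ ≤ h * (‖V‖ + ‖Q‖ * ‖Y‖))
    (hT : ‖T - (S + Y)‖ ≤ h * (‖S‖ + ‖Y‖))
    (hR : ‖Q * R - A‖ ≤ d) (hd : d + 60 * h * N + 2 * η * N ≤ x * σ)
    (hio : 0 < sigmaMin W → kappa W ≤ τ * (N / σ) →
      (∃ ΔW, W + ΔW = Q' * R' ∧ ‖ΔW‖ ≤ η * ‖W‖) ∧ ‖1 - Q'ᵀ * Q'‖ ≤ η * kappa W ^ α)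
    (hη1 : η * (τ * (N / σ)) ^ β ≤ 1) :
    ‖Q * T + Q' * R' - B‖ ≤ (60 * h + 2 * η) * N ∧ ‖1 - Q'ᵀ * Q'‖ ≤ η * (τ * (N / σ)) ^ β ∧
      ‖Qᵀ * Q'‖ ≤ 4 * (N / σ) * (2 * ω ^ 2 + 88 * h + 4 * η) := by
  have hN : 0 < N := hσ.trans_le hσN
  have hd0 : 0 ≤ d := (norm_nonneg _).trans hR
  have hhN : 0 ≤ h * N := by positivity
  have hηN : 0 ≤ η * N := by positivity
  have hxσ : x * σ ≤ 1 / 2 * σ := by gcongr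
  have hx0 : 0 ≤ x := by
    by_contra! hneg
    linarith [mul_neg_of_neg_of_pos hneg hσ]
  have hhx : 60 * h ≤ x := by
    have : x * σ ≤ x * N := by gcongr
    exact le_of_mul_le_mul_right (by linarith) hN
  obtain ⟨hV1, hW1, hW2, hres⟩ :=
    norm_two_projection_steps (hQ.trans hω) hB h0 (hh.trans (by norm_num)) hS hV hY hW hT
  have hlow := lower_bound_of_residual hu hv hR (by linarith) hres
  have hmin : (1 - x) * σ ≤ sigmaMin W :=
    le_sigmaMin W fun v =>
      (mul_le_mul_of_nonneg_right (by linarith) (norm_nonneg v)).trans (hlow v)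
  have h1x : 0 < 1 - x := by linarith
  have hmin0 : 0 < sigmaMin W := (mul_pos h1x hσ).trans_le hmin
  have hWN : ‖W‖ ≤ (1 + x) * N := hW2.trans (by gcongr)
  have hkW : kappa W ≤ τ * (N / σ) := by
    rw [kappa, sigmaMax_eq_norm]
    calc ‖W‖ / sigmaMin W ≤ (1 + x) * N / ((1 - x) * σ) := by gcongr
      _ ≤ τ * (1 - x) * N / ((1 - x) * σ) := by gcongr
      _ = τ * (N / σ) := by field_simp
  obtain ⟨⟨ΔW, hΔ, hΔn⟩, horth⟩ := hio hmin0 hkW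
  have hk1 := one_le_kappa W hmin0
  have horth' : ‖1 - Q'ᵀ * Q'‖ ≤ η * (τ * (N / σ)) ^ β := by
    refine horth.trans (mul_le_mul_of_nonneg_left ?_ hη)
    exact (Real.rpow_le_rpow_of_exponent_le hk1 hαβ).trans
      (Real.rpow_le_rpow (by linarith) hkW hβ)
  have hΔN : ‖ΔW‖ ≤ 2 * η * N := by
    refine hΔn.trans ?_
    have : η * ‖W‖ ≤ η * (2 * N) := by
      gcongr
      exact hWN.trans (by gcongr; linarith)
    linarith
  refine ⟨?_, horth', ?_⟩
  · rw [← hΔ, show Q * T + (W + ΔW) - B = (Q * T + W - B) + ΔW by abel]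
    linarith [norm_add_le (Q * T + W - B) ΔW]
  -- The summand 2ηN in `hd` pays for the backward error `ΔW`, and x ≤ 1/2 leaves σ/2.
  · have hZ : ∀ u, σ / 2 * ‖u‖ ≤ ‖Matrix.toEuclideanLin (W + ΔW) u‖ := fun u => by
      have h1 := hlow u
      have h2 := norm_sub_norm_le (Matrix.toEuclideanLin W u) (-Matrix.toEuclideanLin ΔW u)
      have h3 : ‖Matrix.toEuclideanLin ΔW u‖ ≤ 2 * η * N * ‖u‖ :=
        (norm_toEuclideanLin_le _ _).trans (mul_le_mul_of_nonneg_right hΔN (norm_nonneg _))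
      have h4 : σ / 2 * ‖u‖ ≤ (σ - d - 60 * h * N - 2 * η * N) * ‖u‖ :=
        mul_le_mul_of_nonneg_right (by linarith) (norm_nonneg _)
      rw [norm_neg, sub_neg_eq_add] at h2
      rw [map_add, LinearMap.add_apply]
      linarith
    have hQZ := norm_transpose_mul_le_of_two_steps (Z := W + ΔW) (e := 2 * η * N) hω hQ hB hV1 hW1
      (by rwa [add_sub_cancel_left])
    refine (norm_mul_le_of_factorization (half_pos hσ) hΔ hZ
      (norm_le_two_of_norm_one_sub_le (horth'.trans hη1)) hQZ).trans (le_of_eq ?_)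
    field_simp
    ring

end OrthogonalizationStep

/-! ### Blocks as column selections; triangular products -/

section Blocks

variable {μ ι ν κ : Type*} [Fintype μ] [DecidableEq μ] [Fintype ι] [DecidableEq ι]
  [Fintype ν] [DecidableEq ν] [Fintype κ] [DecidableEq κ]

lemma sigmaMin_mul_norm_le_of_columns (A : Matrix μ κ ℝ) {f : ι → κ} {g : ν → κ}
    (hfg : Function.Injective (Sum.elim f g)) (u : EuclideanSpace ℝ ι) (v : EuclideanSpace ℝ ν) :
    sigmaMin A * ‖u‖ ≤ ‖Matrix.toEuclideanLin (A.submatrix id f) u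
        + Matrix.toEuclideanLin (A.submatrix id g) v‖ ∧
      sigmaMin A * ‖v‖ ≤ ‖Matrix.toEuclideanLin (A.submatrix id f) u
        + Matrix.toEuclideanLin (A.submatrix id g) v‖ := by
  have h0 : 0 ≤ sigmaMin A := LinearMap.singularValues_nonneg _ _
  -- Glue u and v into one coefficient vector; the default 0 switches off all other columns.
  set w : κ → ℝ := Function.extend (Sum.elim f g) (Sum.elim u.ofLp v.ofLp) 0 with hw
  have hwu : w ∘ f = u.ofLp := funext fun a => hfg.extend_apply _ _ (Sum.inl a)
  have hwv : w ∘ g = v.ofLp := funext fun a => hfg.extend_apply _ _ (Sum.inr a)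
  have hA : Matrix.toEuclideanLin (A.submatrix id f) u + Matrix.toEuclideanLin (A.submatrix id g) v
      = Matrix.toEuclideanLin A (WithLp.toLp 2 w) := by
    ext i
    simp only [Matrix.toLpLin_apply, PiLp.add_apply, Matrix.mulVec, dotProduct,
      Matrix.submatrix_apply, id_eq]
    rw [← Fintype.sum_of_injective (Sum.elim f g) hfg
      (Sum.elim (fun a => A i (f a) * u.ofLp a) fun a => A i (g a) * v.ofLp a), Fintype.sum_sum_type]
    · simp
    · intro j hj
      rw [hw, Function.extend_apply' _ _ _ (by simpa using hj)]
      simp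
    · rintro (a | a)
      · simp [← hwu]
      · simp [← hwv]
  rw [hA]
  have h1 := sigmaMin_mul_norm_le A (WithLp.toLp 2 w)
  constructor
  · refine le_trans (mul_le_mul_of_nonneg_left ?_ h0) h1
    have := norm_toLp_comp_le (hfg.comp Sum.inl_injective) w
    rwa [Sum.elim_comp_inl, hwu] at this
  · refine le_trans (mul_le_mul_of_nonneg_left ?_ h0) h1
    have := norm_toLp_comp_le (hfg.comp Sum.inr_injective) w
    rwa [Sum.elim_comp_inr, hwv] at this

variable {m p s : ℕ}

/-- The columns of the blocks that precede block `k`, among all columns. -/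
def beforeIndex (k : Fin p) (jb : {j : Fin p // j < k} × Fin s) : Fin p × Fin s :=
  (jb.1.1, jb.2)

lemma sumElim_beforeIndex_injective (k : Fin p) :
    Function.Injective (Sum.elim (beforeIndex (s := s) k) (Prod.mk k)) := by
  rintro (⟨⟨j, hj⟩, a⟩ | a) (⟨⟨l, hl⟩, b⟩ | b) h
  · simpa [beforeIndex] using h
  · simp [beforeIndex] at h
    exact absurd h.1 hj.ne
  · simp [beforeIndex] at h
    exact absurd h.1.symm hl.ne
  · simpa using h

lemma beforeIndex_injective (k : Fin p) : Function.Injective (beforeIndex (s := s) k) :=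
  (sumElim_beforeIndex_injective k).comp Sum.inl_injective

lemma norm_block_le (X : Fin p → Matrix (Fin m) (Fin s) ℝ) (k : Fin p) : ‖X k‖ ≤ ‖concat X‖ :=
  norm_submatrix_le (concat X) (f := Prod.mk k) (Prod.mk_right_injective k)

lemma block_columns_bound (X : Fin p → Matrix (Fin m) (Fin s) ℝ) (k : Fin p)
    (u : EuclideanSpace ℝ ({j : Fin p // j < k} × Fin s)) (v : EuclideanSpace ℝ (Fin s)) :
    sigmaMin (concat X) * ‖u‖
        ≤ ‖Matrix.toEuclideanLin (concatBefore X k) u + Matrix.toEuclideanLin (X k) v‖ ∧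
      sigmaMin (concat X) * ‖v‖
        ≤ ‖Matrix.toEuclideanLin (concatBefore X k) u + Matrix.toEuclideanLin (X k) v‖ :=
  sigmaMin_mul_norm_le_of_columns (concat X) (sumElim_beforeIndex_injective k) u v

lemma sigmaMin_concat_le_block [NeZero s] (X : Fin p → Matrix (Fin m) (Fin s) ℝ) (k : Fin p) :
    sigmaMin (concat X) ≤ sigmaMin (X k) :=
  le_sigmaMin _ fun v => by simpa using (block_columns_bound X k 0 v).2

lemma kappa_block_le [NeZero p] [NeZero s] (X : Fin p → Matrix (Fin m) (Fin s) ℝ) (k : Fin p)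
    (h : 0 < sigmaMin (concat X)) : kappa (X k) ≤ kappa (concat X) := by
  rw [kappa, kappa, sigmaMax_eq_norm, sigmaMax_eq_norm]
  exact div_le_div₀ (norm_nonneg _) (norm_block_le X k) h (sigmaMin_concat_le_block X k)

lemma gram_submatrix (Q : Fin p → Matrix (Fin m) (Fin s) ℝ) (k : Fin p) :
    1 - (concatBefore Q k)ᵀ * concatBefore Q k
      = (1 - (concat Q)ᵀ * concat Q).submatrix (beforeIndex k) (beforeIndex k) := by
  rw [Matrix.submatrix_sub, Pi.sub_apply, Pi.sub_apply,
    Matrix.submatrix_one _ (beforeIndex_injective k)]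
  rfl

/-- By block triangularity, columns before block k involve only the blocks of Q before k. -/
lemma concat_mul_blockMatrix_before {Q : Fin p → Matrix (Fin m) (Fin s) ℝ}
    {R : Fin p → Fin p → Matrix (Fin s) (Fin s) ℝ} (hR : ∀ j k : Fin p, k < j → R j k = 0)
    (k : Fin p) :
    concatBefore Q k * (blockMatrix R).submatrix (beforeIndex k) (beforeIndex k)
      = (concat Q * blockMatrix R).submatrix id (beforeIndex k) := by
  ext i ⟨⟨l, hl⟩, b⟩
  rw [Matrix.mul_apply, Matrix.submatrix_apply, Matrix.mul_apply]
  refine Fintype.sum_of_injective (beforeIndex k) (beforeIndex_injective k) _ _ ?_ fun _ => rfl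
  rintro ⟨j, a⟩ hj
  have hjk : ¬ j < k := fun h => hj ⟨(⟨j, h⟩, a), rfl⟩
  have : R j l = 0 := hR j l (hl.trans_le (not_lt.1 hjk))
  simp [blockMatrix, beforeIndex, this]

lemma concat_mul_blockMatrix_block {Q : Fin p → Matrix (Fin m) (Fin s) ℝ}
    {R : Fin p → Fin p → Matrix (Fin s) (Fin s) ℝ} (hR : ∀ j k : Fin p, k < j → R j k = 0)
    (k : Fin p) :
    concatBefore Q k * blockColumn R k + Q k * R k k
      = (concat Q * blockMatrix R).submatrix id (Prod.mk k) := by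
  ext i b
  rw [Matrix.add_apply, Matrix.mul_apply, Matrix.mul_apply, Matrix.submatrix_apply,
    Matrix.mul_apply, ← Fintype.sum_of_injective _ (sumElim_beforeIndex_injective k)
      (Sum.elim (fun ja => concatBefore Q k i ja * blockColumn R k ja b)
        fun a => Q k i a * R k k a b), Fintype.sum_sum_type]
  · simp
  · rintro ⟨j, a⟩ hj
    have hjk : k < j := by
      by_contra! h
      rcases h.lt_or_eq with h | rfl
      · exact hj ⟨Sum.inl (⟨j, h⟩, a), rfl⟩
      · exact hj ⟨Sum.inr a, rfl⟩
    simp [blockMatrix, hR j k hjk]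
  · rintro (a | a) <;> rfl

end Blocks

/-! ### Induction over the blocks -/

section Induction

/-- The constant in the bound `orthConstant k * ε * κ ^ β` for the loss of orthogonality among the
first `k` blocks. -/
noncomputable def orthConstant (L c K : ℝ) : ℕ → ℝ
  | 0 => 1
  | k + 1 => orthConstant L c K k + (8 * L ^ 2 * orthConstant L c K k ^ 2 + 352 * L + 16 * c + c * K)

lemma orthConstant_le_succ {L c K : ℝ} (hL : 0 ≤ L) (hc : 0 ≤ c) (hK : 0 ≤ K) (k : ℕ) :
    orthConstant L c K k ≤ orthConstant L c K (k + 1) := by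
  rw [orthConstant]
  exact le_add_of_nonneg_right (by positivity)

lemma orthConstant_monotone {L c K : ℝ} (hL : 0 ≤ L) (hc : 0 ≤ c) (hK : 0 ≤ K) :
    Monotone (orthConstant L c K) :=
  monotone_nat_of_le_succ (orthConstant_le_succ hL hc hK)

lemma one_le_orthConstant {L c K : ℝ} (hL : 0 ≤ L) (hc : 0 ≤ c) (hK : 0 ≤ K) (k : ℕ) :
    1 ≤ orthConstant L c K k :=
  orthConstant_monotone hL hc hK (Nat.zero_le k)

variable {m p s : ℕ} [NeZero p] [NeZero s]

lemma card_beforeIndex_le (k : Fin p) : Fintype.card ({j : Fin p // j < k} × Fin s) ≤ p * s := by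
  simpa using Fintype.card_le_of_injective _ (beforeIndex_injective (s := s) k)

lemma IntraOrthoBounds.mono_left {io : IntraOrtho m s} {η η' a : ℝ} {B : Matrix (Fin m) (Fin s) ℝ}
    (h : IntraOrthoBounds io η a B) (hη : η ≤ η') (hB : 0 < sigmaMin B) :
    IntraOrthoBounds io η' a B := by
  obtain ⟨⟨ΔX, h1, h2⟩, h3⟩ := h
  have := one_le_kappa B hB
  exact ⟨⟨ΔX, h1, h2.trans (by gcongr)⟩, h3.trans (by gcongr)⟩

/-- The bounds for block `k` that follow from those for the preceding blocks. -/
theorem computed_block_bounds {ε αA α β τ c L N κ e : ℝ} {n : ℕ} {ioA io : IntraOrtho m s}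
    {X Q : Fin p → Matrix (Fin m) (Fin s) ℝ} {R : Fin p → Fin p → Matrix (Fin s) (Fin s) ℝ}
    (hn : n = m + p * s + 1) (hL : L = roundingFactor n) (hε : 0 < ε) (hc : 0 ≤ c) (hτ : 1 < τ)
    (hαA : αA ≤ β) (hα : α ≤ β) (hβ : 1 ≤ β)
    (hσ : 0 < sigmaMin (concat X)) (hN : N = ‖concat X‖) (hκ : κ = kappa (concat X))
    (hA : ∀ B : Matrix (Fin m) (Fin s) ℝ, 0 < sigmaMin B → kappa B ≤ κ →
      IntraOrthoBounds ioA (c * ε) αA B)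
    (hio : ∀ B : Matrix (Fin m) (Fin s) ℝ, 0 < sigmaMin B → kappa B ≤ τ * κ →
      IntraOrthoBounds io (c * ε) α B)
    (hε1 : ε ≤ 1) (hLε : L * ε ≤ 1 / 60) (he : 1 ≤ e) (heε : L * e * (ε * κ ^ β) ≤ 1)
    (hcε : c * ε * (τ * κ) ^ β ≤ 1) (hθ : ε * κ ^ (β + 1) ≤ 1)
    (hx : (L * (60 * L + 2 * c) + 60 * L + 2 * c) * (ε * κ) ≤ 1 / 2)
    (hxτ : 1 + (L * (60 * L + 2 * c) + 60 * L + 2 * c) * (ε * κ)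
      ≤ τ * (1 - (L * (60 * L + 2 * c) + 60 * L + 2 * c) * (ε * κ)))
    (hcomp : IsComputedBCGSIA3S ε ioA io X Q R) (k : Fin p)
    (horth : ‖1 - (concatBefore Q k)ᵀ * concatBefore Q k‖ ≤ L * e * (ε * κ ^ β))
    (hres : ‖concatBefore Q k * (blockMatrix R).submatrix (beforeIndex k) (beforeIndex k)
      - concatBefore X k‖ ≤ L * ((60 * L + 2 * c) * ε * N)) :
    ‖concatBefore Q k * blockColumn R k + Q k * R k k - X k‖ ≤ (60 * L + 2 * c) * ε * N ∧
      ‖1 - (Q k)ᵀ * Q k‖ ≤ c * τ ^ β * (ε * κ ^ β) ∧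
      ‖(concatBefore Q k)ᵀ * Q k‖ ≤ (8 * L ^ 2 * e ^ 2 + 352 * L + 16 * c) * (ε * κ ^ β) := by
  have hn0 : 0 < n := by omega
  have hL1 : 1 ≤ L := hL ▸ one_le_roundingFactor hn0
  have hκ1 : 1 ≤ κ := hκ ▸ one_le_kappa _ hσ
  have hκ0 : 0 < κ := one_pos.trans_le hκ1
  have hσN : sigmaMin (concat X) ≤ N := hN ▸ sigmaMin_le_norm _
  have hN0 : 0 < N := hσ.trans_le hσN
  have hκβ : 0 < κ ^ β := Real.rpow_pos_of_pos hκ0 β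
  have hτβ : 1 ≤ τ ^ β := Real.one_le_rpow hτ.le (by linarith)
  rcases eq_or_ne k 0 with rfl | hk
  · have : IsEmpty {j : Fin p // j < 0} := ⟨fun j => absurd j.2 (by simp)⟩
    have hX0 := hσ.trans_le (sigmaMin_concat_le_block X 0)
    have hkX : kappa (X 0) ≤ κ := hκ ▸ kappa_block_le X 0 hσ
    obtain ⟨⟨ΔX, h1, h2⟩, h3⟩ := hA (X 0) hX0 hkX
    have hQ0 : Q 0 = (ioA (X 0)).1 := congrArg Prod.fst hcomp.first
    have hR0 : R 0 0 = (ioA (X 0)).2 := congrArg Prod.snd hcomp.first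
    rw [← hQ0, ← hR0] at h1
    rw [← hQ0] at h3
    refine ⟨?_, ?_, ?_⟩
    · have h4 : concatBefore Q 0 * blockColumn R 0 = 0 := by
        ext i j
        simp [Matrix.mul_apply]
      rw [h4, zero_add, ← h1, add_sub_cancel_left]
      refine h2.trans ?_
      have h5 : ‖X 0‖ ≤ N := hN ▸ norm_block_le X 0
      have h6 : c * ε * ‖X 0‖ ≤ c * ε * N := by gcongr
      have h7 : 0 ≤ c * ε * N := by positivity
      have h8 : 0 ≤ L * ε * N := by positivity
      linarith
    · refine h3.trans ?_
      have h4 : kappa (X 0) ^ αA ≤ κ ^ β :=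
        (Real.rpow_le_rpow_of_exponent_le (one_le_kappa _ hX0) hαA).trans
          (Real.rpow_le_rpow (by linarith [one_le_kappa _ hX0]) hkX (by linarith))
      calc c * ε * kappa (X 0) ^ αA ≤ c * ε * κ ^ β := by gcongr
        _ ≤ c * ε * κ ^ β * τ ^ β := le_mul_of_one_le_right (by positivity) hτβ
        _ = _ := by ring
    · have h4 : (concatBefore Q 0)ᵀ * Q 0 = 0 := Subsingleton.elim _ _
      rw [h4, norm_zero]
      positivity
  · obtain ⟨S, Y, V, W, hS, hV, hY, hW, hQR, hT⟩ := hcomp.step k hk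
    have hm : Fintype.card (Fin m) ≤ n := by simp; omega
    have hs : Fintype.card (Fin s) ≤ n := by
      have : s ≤ p * s := Nat.le_mul_of_pos_left s (Nat.pos_of_neZero p)
      simp; omega
    have hι : Fintype.card ({j : Fin p // j < k} × Fin s) ≤ n := by
      have := card_beforeIndex_le (s := s) k
      omega
    have hQk : Q k = (io W).1 := congrArg Prod.fst hQR
    have hRk : R k k = (io W).2 := congrArg Prod.snd hQR
    have hκN : κ = N / sigmaMin (concat X) := by rw [hκ, hN, kappa, sigmaMax_eq_norm]
    have hκσ : κ * sigmaMin (concat X) = N := by rw [hκN]; field_simp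
    have hcol := block_columns_bound X k
    -- The value of x turns `hd` into an equality: d = L(60L + 2c)εN comes from `hres`, and N = κσ.
    have key := orthogonalization_step (R := (blockMatrix R).submatrix (beforeIndex k) (beforeIndex k))
      (R' := R k k) (Q' := Q k) (α := α) (β := β) (τ := τ)
      (x := (L * (60 * L + 2 * c) + 60 * L + 2 * c) * (ε * κ)) hσ hσN (h := L * ε) (η := c * ε)
      (by positivity) (by positivity) hx hxτ hLε heε hα (by linarith)
      (fun u v => (hcol u v).1) (fun u v => (hcol u v).2) horth (hN ▸ norm_block_le X k)
      (hL ▸ hS.norm_sub_le hn0 hι hm hs hε.le hε1) (hL ▸ hV.norm_sub_le hn0 hm hι hs hε.le hε1)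
      (hL ▸ hY.norm_sub_le hn0 hι hm hs hε.le hε1) (hL ▸ hW.norm_sub_le hn0 hm hι hs hε.le hε1)
      (hL ▸ hT.norm_sub_le hn0 hι hs hε.le) hres
      (by rw [← hκσ]; exact le_of_eq (by ring))
      (fun h1 h2 => by
        rw [hQk, hRk]
        exact hio W h1 (by rwa [hκN]))
      (by rwa [← hκN])
    rw [← hκN] at key
    obtain ⟨k1, k2, k3⟩ := key
    refine ⟨k1.trans (le_of_eq (by ring)), k2.trans (le_of_eq ?_), k3.trans ?_⟩
    · rw [Real.mul_rpow (by linarith) hκ0.le]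
      ring
    -- The linear terms carry εκ ≤ εκ^β. In the quadratic one, εκ^(β+1) ≤ 1 removes the surplus
    -- factor.
    · have h1 : κ ≤ κ ^ β := by
        simpa using Real.rpow_le_rpow_of_exponent_le hκ1 hβ
      have h2 : κ ^ (β + 1) = κ ^ β * κ := by rw [Real.rpow_add hκ0, Real.rpow_one]
      rw [h2] at hθ
      have h3 : (352 * L + 16 * c) * ε * κ ≤ (352 * L + 16 * c) * ε * κ ^ β := by gcongr
      have h4 : 8 * L ^ 2 * e ^ 2 * (ε * κ ^ β) * (ε * (κ ^ β * κ))
          ≤ 8 * L ^ 2 * e ^ 2 * (ε * κ ^ β) * 1 := by gcongr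
      linarith

/-- If every block column obeys its bounds whenever the preceding ones do, then all columns obey
the bounds. -/
theorem entrywise_bounds {X Q : Fin p → Matrix (Fin m) (Fin s) ℝ}
    {R : Fin p → Fin p → Matrix (Fin s) (Fin s) ℝ} (hR : ∀ j k : Fin p, k < j → R j k = 0)
    {b : ℕ → ℝ} (hb : Monotone b) (hb0 : ∀ k, 0 ≤ b k) {r L : ℝ} (hr : 0 ≤ r) {n : ℕ}
    (hn : n = m + p * s + 1) (hL : L = roundingFactor n)
    (step : ∀ k : Fin p, ‖1 - (concatBefore Q k)ᵀ * concatBefore Q k‖ ≤ L * b k →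
      ‖concatBefore Q k * (blockMatrix R).submatrix (beforeIndex k) (beforeIndex k)
        - concatBefore X k‖ ≤ L * r →
      ‖concatBefore Q k * blockColumn R k + Q k * R k k - X k‖ ≤ r ∧
      ‖1 - (Q k)ᵀ * Q k‖ ≤ b (k + 1) ∧ ‖(concatBefore Q k)ᵀ * Q k‖ ≤ b (k + 1))
    (k : ℕ) (hk : k ≤ p) :
    (∀ i j : Fin p × Fin s, i.1.1 < k → j.1.1 < k →
      |(1 - (concat Q)ᵀ * concat Q : Matrix (Fin p × Fin s) (Fin p × Fin s) ℝ) i j|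
         ≤ b k) ∧
    (∀ i, ∀ j : Fin p × Fin s, j.1.1 < k →
      |(concat Q * blockMatrix R - concat X) i j| ≤ r) := by
  -- Entrywise bounds extend to a new block without loss; L enters only in passing to the norms that
  -- `step` assumes. Hence the residual bound r is the same for all blocks.
  induction k with
  | zero => exact ⟨fun i j h => absurd h (by omega), fun i j h => absurd h (by omega)⟩
  | succ k ih =>
    obtain ⟨ih1, ih2⟩ := ih (by omega)
    have hn0 : 0 < n := by omega
    set K : Fin p := ⟨k, by omega⟩ with hK
    have hι : Fintype.card ({j : Fin p // j < K} × Fin s) ≤ n := by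
      have := card_beforeIndex_le (s := s) K
      omega
    have hm : Fintype.card (Fin m) ≤ n := by simp; omega
    obtain ⟨h1, h2, h3⟩ := step K
      (hL ▸ norm_le_roundingFactor_mul' hn0 hι hι _ (hb0 _) fun i j => by
        rw [gram_submatrix]
        exact ih1 _ _ i.1.2 j.1.2)
      (hL ▸ norm_le_roundingFactor_mul' hn0 hm hι _ hr fun i j => by
        rw [concat_mul_blockMatrix_before hR]
        exact ih2 _ _ j.1.2)
    have hmix : ∀ (i : Fin p × Fin s) (a : Fin s), i.1.1 < k →
        |(1 - (concat Q)ᵀ * concat Q : Matrix (Fin p × Fin s) (Fin p × Fin s) ℝ)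
          i (K, a)| ≤ b (k + 1) ∧
        |(1 - (concat Q)ᵀ * concat Q : Matrix (Fin p × Fin s) (Fin p × Fin s) ℝ)
          (K, a) i| ≤ b (k + 1) := by
      rintro ⟨i, c⟩ a hi
      have hne : i ≠ K := fun h => by simp [h, hK] at hi
      have h4 := (abs_apply_le_norm _ ((⟨i, hi⟩, c) : {j : Fin p // j < K} × Fin s) a).trans h3
      constructor
      · rw [Matrix.sub_apply, Matrix.one_apply_ne (by simp [hne]), zero_sub, abs_neg]
        exact h4
      · rw [Matrix.sub_apply, Matrix.one_apply_ne (by simp [hne.symm]), zero_sub, abs_neg,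
          Matrix.mul_apply]
        rw [Matrix.mul_apply] at h4
        exact (congrArg abs (Finset.sum_congr rfl fun l _ => mul_comm _ _)).trans_le h4
    constructor
    · rintro ⟨i, a⟩ ⟨j, c⟩ hi hj
      rcases Nat.lt_succ_iff_lt_or_eq.1 hi with hi | hi <;>
        rcases Nat.lt_succ_iff_lt_or_eq.1 hj with hj | hj
      · exact (ih1 _ _ hi hj).trans (hb (Nat.le_succ k))
      · obtain rfl : j = K := Fin.ext hj
        exact (hmix (i, a) c hi).1
      · obtain rfl : i = K := Fin.ext hi
        exact (hmix (j, c) a hj).2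
      · obtain rfl : i = K := Fin.ext hi
        obtain rfl : j = K := Fin.ext hj
        refine le_trans (le_of_eq ?_) ((abs_apply_le_norm _ a c).trans h2)
        rw [Matrix.sub_apply, Matrix.sub_apply]
        congr 2
        simp [Matrix.one_apply]
    · rintro i ⟨j, c⟩ hj
      rcases Nat.lt_succ_iff_lt_or_eq.1 hj with hj | hj
      · exact ih2 _ _ hj
      · obtain rfl : j = K := Fin.ext hj
        rw [concat_mul_blockMatrix_block hR] at h1
        exact (abs_apply_le_norm _ i c).trans h1

end Induction

end BlockGS

/-! ### Choice of constants and conclusion -/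

theorem mainTheorem5 (m p s : ℕ) [NeZero p] [NeZero s] (αA α c τ : ℝ) (hα : αA ≤ α) (hτ : 1 < τ) :
    ∃ C₀ C₁ C₂ : ℝ, 0 < C₀ ∧ 0 < C₁ ∧ 0 < C₂ ∧
      ∀ (ε : ℝ) (ioA io : BlockGS.IntraOrtho m s) (X : Fin p → Matrix (Fin m) (Fin s) ℝ),
        0 < ε →
        0 < BlockGS.sigmaMin (BlockGS.concat X) →
        (∀ B : Matrix (Fin m) (Fin s) ℝ, 0 < BlockGS.sigmaMin B →
          BlockGS.kappa B ≤ BlockGS.kappa (BlockGS.concat X) →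
          BlockGS.IntraOrthoBounds ioA (c * ε) αA B) →
        (∀ B : Matrix (Fin m) (Fin s) ℝ, 0 < BlockGS.sigmaMin B →
          BlockGS.kappa B ≤ τ * BlockGS.kappa (BlockGS.concat X) →
          BlockGS.IntraOrthoBounds io (c * ε) α B) →
        C₀ * ε * BlockGS.kappa (BlockGS.concat X) ^ max (α + 1) 2 ≤ 1 / 2 →
        ∀ (Q : Fin p → Matrix (Fin m) (Fin s) ℝ)
          (R : Fin p → Fin p → Matrix (Fin s) (Fin s) ℝ),
          BlockGS.IsComputedBCGSIA3S ε ioA io X Q R →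
          (∃ ΔX : Matrix (Fin m) (Fin p × Fin s) ℝ,
            BlockGS.concat X + ΔX = BlockGS.concat Q * BlockGS.blockMatrix R ∧
            ‖ΔX‖ ≤ C₁ * ε * ‖BlockGS.concat X‖) ∧
          ‖(1 : Matrix (Fin p × Fin s) (Fin p × Fin s) ℝ) -
              (BlockGS.concat Q)ᵀ * BlockGS.concat Q‖ ≤
            C₂ * ε * BlockGS.kappa (BlockGS.concat X) ^ max α 1 := by
  obtain ⟨n, hn⟩ : ∃ n, n = m + p * s + 1 := ⟨_, rfl⟩
  obtain ⟨L, hL⟩ : ∃ L, L = BlockGS.roundingFactor n := ⟨_, rfl⟩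
  have hn0 : 0 < n := by omega
  have hL1 : 1 ≤ L := hL ▸ BlockGS.one_le_roundingFactor hn0
  have hL0 : 0 ≤ L := by linarith
  have hθ : max (α + 1) 2 = max α 1 + 1 := by rw [← max_add_add_right]; norm_num
  have hβ : 1 ≤ max α 1 := le_max_right _ _
  have hαβ : α ≤ max α 1 := le_max_left _ _
  rw [hθ]
  set β := max α 1
  have hK : 0 ≤ τ ^ β := Real.rpow_nonneg (by linarith) _
  -- The constant c may be negative, so everything is run with |c|.
  have hc := abs_nonneg c
  have hmono := BlockGS.orthConstant_monotone (K := τ ^ β) hL0 hc hK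
  have hone := BlockGS.one_le_orthConstant (K := τ ^ β) hL0 hc hK
  set oc := BlockGS.orthConstant L |c| (τ ^ β) with hoc
  set g := L * (60 * L + 2 * |c|) + 60 * L + 2 * |c| with hg
  have hg0 : 0 ≤ g := by positivity
  have hocp := hone p
  have h1 : 0 ≤ L * oc p := by positivity
  have h2 : 0 ≤ |c| * τ ^ β := by positivity
  have h3 : 0 ≤ g * (τ + 1) / (τ - 1) :=
    div_nonneg (mul_nonneg hg0 (by linarith)) (by linarith)
  -- Each summand of C₀ secures one smallness condition: ε ≤ 1, Lε ≤ 1/60, ω ≤ 1, |c|ε(τκ)^β ≤ 1, x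
  -- ≤ 1/2 and x(1 + τ) ≤ τ - 1, with x = gεκ. The other two constants are the final entrywise
  -- bounds times L.
  refine ⟨1 + 30 * L + L * oc p + |c| * τ ^ β + g + g * (τ + 1) / (τ - 1),
    L * (60 * L + 2 * |c|), L * oc p, by positivity, by positivity, by positivity, ?_⟩
  intro ε ioA io X hε hσ hA hio hC Q R hcomp
  have hκ1 := BlockGS.one_le_kappa (BlockGS.concat X) hσ
  set κ := BlockGS.kappa (BlockGS.concat X) with hκ
  set N := ‖BlockGS.concat X‖ with hN
  have hκβ : ε * κ ^ β ≤ ε * κ ^ (β + 1) := by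
    gcongr
    linarith
  have hκκ : ε * κ ≤ ε * κ ^ (β + 1) := by
    gcongr
    simpa using Real.rpow_le_rpow_of_exponent_le hκ1 (show 1 ≤ β + 1 by linarith)
  have hκε : ε ≤ ε * κ := le_mul_of_one_le_right hε.le hκ1
  have hκβ0 : 0 ≤ ε * κ ^ β := by positivity
  rw [mul_assoc] at hC
  set E := ε * κ ^ (β + 1) with hE
  have hE0 : 0 ≤ E := by positivity
  have hsmall : ∀ a, a ≤ 1 + 30 * L + L * oc p + |c| * τ ^ β + g + g * (τ + 1) / (τ - 1) →
      a * E ≤ 1 / 2 := fun a ha => (mul_le_mul_of_nonneg_right ha hE0).trans hC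
  have hE1 := hsmall 1 (by linarith)
  have hEL := hsmall (30 * L) (by linarith)
  have hEo := hsmall (L * oc p) (by linarith)
  have hEc := hsmall (|c| * τ ^ β) (by linarith)
  have hEg := hsmall g (by linarith)
  have hEτ := hsmall (g * (τ + 1) / (τ - 1)) (by linarith)
  have hgκ : g * (ε * κ) ≤ g * E := by gcongr
  have hgτ : g * (ε * κ) * (1 + τ) ≤ τ - 1 := by
    rw [div_mul_eq_mul_div, div_le_iff₀ (by linarith)] at hEτ
    have : g * (ε * κ) * (1 + τ) ≤ g * E * (1 + τ) := by gcongr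
    linarith
  have hcc : c * ε ≤ |c| * ε := by
    gcongr
    exact le_abs_self c
  have hbound := BlockGS.entrywise_bounds (X := X) (Q := Q) hcomp.lower
    (b := fun k => oc k * (ε * κ ^ β))
    (fun i j hij => mul_le_mul_of_nonneg_right (hmono hij) hκβ0)
    (fun k => mul_nonneg (by linarith [hone k]) hκβ0)
    (r := (60 * L + 2 * |c|) * ε * N) (by positivity) hn hL
    (fun k horth hres => by
      have hk : oc k ≤ oc p := hmono k.2.le
      obtain ⟨b1, b2, b3⟩ := BlockGS.computed_block_bounds (e := oc k) (β := β) hn hL hε hc hτ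
        (hα.trans hαβ) hαβ hβ hσ hN hκ (fun B h h' => (hA B h h').mono_left hcc h)
        (fun B h h' => (hio B h h').mono_left hcc h) (by linarith)
        (by
          have : L * ε ≤ L * E := by gcongr; linarith
          linarith) (hone k)
        (by
          have : L * oc k * (ε * κ ^ β) ≤ L * oc p * E := by gcongr
          linarith)
        (by
          rw [Real.mul_rpow (by linarith) (by linarith)]
          have : |c| * τ ^ β * (ε * κ ^ β) ≤ |c| * τ ^ β * E := by gcongr
          linarith)
        (by linarith) (by linarith) (by linarith) hcomp k (by rwa [mul_assoc]) hres
      have hoc1 : oc (k + 1)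
          = oc k + (8 * L ^ 2 * oc k ^ 2 + 352 * L + 16 * |c| + |c| * τ ^ β) := rfl
      have hock := hone k
      have h4 : 0 ≤ 8 * L ^ 2 * oc k ^ 2 + 352 * L + 16 * |c| := by positivity
      exact ⟨b1, b2.trans (mul_le_mul_of_nonneg_right (by linarith) hκβ0),
        b3.trans (mul_le_mul_of_nonneg_right (by linarith) hκβ0)⟩)
    p le_rfl
  have hm : Fintype.card (Fin m) ≤ n := by simp; omega
  have hps : Fintype.card (Fin p × Fin s) ≤ n := by simp; omega
  refine ⟨⟨BlockGS.concat Q * BlockGS.blockMatrix R - BlockGS.concat X, by abel, ?_⟩, ?_⟩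
  · refine (BlockGS.norm_le_roundingFactor_mul' hn0 hm hps _ (by positivity)
      fun i j => hbound.2 i j j.1.2).trans (le_of_eq ?_)
    rw [← hL]
    ring
  · refine (BlockGS.norm_le_roundingFactor_mul' hn0 hps hps _ (by positivity)
      fun i j => hbound.1 i j i.1.2 j.1.2).trans (le_of_eq ?_)
    rw [← hL]
    ring
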